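/- Let $\Gamma$ be a finite compact connected metric graph with vertex set $V$ and non-empty edge set $E$ (loops and multiple edges allowed), where each edge $e$ is identified with an interval $[0,\ell_e]$, $0<\ell_e<\infty$, and every vertex is a set of endpoints of edges. Let $\mathcal L=\sum_{e\in E}\ell_e$ be its total length. Fix real numbers $\alpha_v$ $(v\in V)$ and put $\alpha=\sum_{v\in V}\alpha_v$. Consider the operator $-\frac{d^2}{dx^2}$ in $L^2(\Gamma)=\bigoplus_{e\in E}L^2(0,\ell_e)$ on the functions $\varphi\in\bigoplus_{e\in E}H^2(0,\ell_e)$ that satisfy the $\delta$-type conditions at every vertex $v$: $\varphi$ takes one common value $\varphi(v)$ at all endpoints of edges belonging to $v$, and the sum of the derivatives of $\varphi$, directed into the edges, over all endpoints belonging to $v$ equals $\alpha_v\varphi(v)$. Its eigenvalues can be listed, each repeated according to its (finite) multiplicity, as a non-decreasing real sequence, and we number them from zero: $\lambda_0\le\lambda_1\le\lambda_2\le\cdots$ (so that, for instance, $\lambda_k=(k\pi/\mathcal L)^2$ for a single interval with $\alpha_v=0$ at both ends). Then for every integer $k\ge 0$: 1. If $\alpha=0$, then $$\lambda_k\le\Big(\frac{(k+|E|)\pi}{\mathcal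 L}\Big)^2,\qquad\text{and if } k\ge|V|-1,\text{ then}\quad \Big(\frac{(k-|V|+1)\pi}{\mathcal L}\Big)^2\le\lambda_k .$$ 2. If $\alpha>0$, then $$\lambda_k\le\Big(\frac{(k+|E|+1)\pi}{\mathcal L}\Big)^2,\qquad\text{and if } k\ge|V|-1,\text{ then}\quad \Big(\frac{(k-|V|+1)\pi}{\mathcal L}\Big)^2\le\lambda_k .$$ 3. If $\alpha<0$, then $$\lambda_k\le\Big(\frac{(k+|E|)\pi}{\mathcal L}\Big)^2,\qquad\text{and if } k\ge|V|,\text{ then}\quad \Big(\frac{(k-|V|)\pi}{\mathcal L}\Big)^2\le\lambda_k .$$ If moreover $k\ge|V|+1$, this last lower bound holds even for the preceding eigenvalue: $\big(\frac{(k-|V|)\pi}{\mathcal L}\big)^2\le\lambda_{k-1}$. -/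

import Mathlib

open MeasureTheory Set

noncomputable section

/-- A finite compact connected metric graph with vertex set `V` and edge set `E`. The edge `e` is
the interval `[0, length e]`; its left endpoint (`false`) and its right endpoint (`true`) belong to
the vertices `vertex e false` and `vertex e true`. So a vertex is a set of endpoints of edges;
loops and multiple edges are allowed. -/
structure MetricGraph (V E : Type*) where
  vertex : E → Bool → V
  length : E → ℝ
  length_pos : ∀ e, 0 < length e
  connected : (SimpleGraph.fromRel
    fun a b : V => ∃ e, vertex e false = a ∧ vertex e true = b).Connected

/-- `g` is the weak derivative of `f` on the interval `(0, l)`. -/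
def HasWeakDeriv (l : ℝ) (f g : ℝ → ℂ) : Prop :=
  IntegrableOn f (Ioo 0 l) ∧ IntegrableOn g (Ioo 0 l) ∧
    ∀ η : ℝ → ℝ, ContDiff ℝ (⊤ : ℕ∞) η → HasCompactSupport η → tsupport η ⊆ Ioo 0 l →
      ∫ x in Ioo 0 l, deriv η x • f x = -∫ x in Ioo 0 l, η x • g x

theorem HasWeakDeriv.integrable_smul {l : ℝ} {f : ℝ → ℂ} (hf : IntegrableOn f (Ioo 0 l))
    {η : ℝ → ℝ} (h1 : Continuous η) (h2 : HasCompactSupport η) :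
    IntegrableOn (fun x => η x • f x) (Ioo 0 l) := by
  obtain ⟨C, hC⟩ := h2.exists_bound_of_continuous h1
  exact Integrable.bdd_smul hf C h1.aestronglyMeasurable (Filter.Eventually.of_forall hC)

theorem HasWeakDeriv.add {l : ℝ} {f g f₁ g₁ : ℝ → ℂ} (h : HasWeakDeriv l f g)
    (h₁ : HasWeakDeriv l f₁ g₁) : HasWeakDeriv l (f + f₁) (g + g₁) := by
  refine ⟨h.1.add h₁.1, h.2.1.add h₁.2.1, fun η a b c => ?_⟩
  have hd : Continuous (deriv η) := a.continuous_deriv (by simp)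
  have e1 := h.2.2 η a b c
  have e2 := h₁.2.2 η a b c
  simp only [Pi.add_apply, smul_add]
  rw [integral_add (HasWeakDeriv.integrable_smul h.1 hd b.deriv)
      (HasWeakDeriv.integrable_smul h₁.1 hd b.deriv),
    integral_add (HasWeakDeriv.integrable_smul h.2.1 a.continuous b)
      (HasWeakDeriv.integrable_smul h₁.2.1 a.continuous b), e1, e2]
  ring

theorem HasWeakDeriv.smul {l : ℝ} {f g : ℝ → ℂ} (c : ℂ) (h : HasWeakDeriv l f g) :
    HasWeakDeriv l (c • f) (c • g) := by
  refine ⟨h.1.smul c, h.2.1.smul c, fun η a b d => ?_⟩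
  have e1 := h.2.2 η a b d
  simp only [Pi.smul_apply, smul_comm _ c]
  rw [integral_smul, integral_smul, e1, smul_neg]

theorem HasWeakDeriv.congr {l : ℝ} {f g g₁ : ℝ → ℂ} (h : HasWeakDeriv l f g)
    (e : g =ᵐ[volume.restrict (Ioo 0 l)] g₁) : HasWeakDeriv l f g₁ := by
  refine ⟨h.1, h.2.1.congr e, fun η a b d => ?_⟩
  rw [h.2.2 η a b d]
  congr 1
  refine integral_congr_ae ?_
  filter_upwards [e] with x hx
  rw [hx]

theorem HasWeakDeriv.zero (l : ℝ) : HasWeakDeriv l 0 0 := by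
  refine ⟨integrableOn_zero, integrableOn_zero, fun η a b d => ?_⟩
  simp

theorem HasWeakDeriv.eq_zero {l : ℝ} {f g : ℝ → ℂ} (h : HasWeakDeriv l f g)
    (e : f =ᵐ[volume.restrict (Ioo 0 l)] 0) : g =ᵐ[volume.restrict (Ioo 0 l)] 0 := by
  have key : ∀ᵐ x ∂volume, x ∈ Ioo 0 l → g x = 0 := by
    refine isOpen_Ioo.ae_eq_zero_of_integral_contDiff_smul_eq_zero
      h.2.1.locallyIntegrableOn ?_
    intro η a b d
    have e1 := h.2.2 η a b d
    have e2 : ∫ x in Ioo 0 l, deriv η x • f x = 0 := by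
      rw [integral_eq_zero_of_ae]
      filter_upwards [e] with x hx
      simp [hx]
    rw [e2, zero_eq_neg] at e1
    rw [← e1]
    refine (setIntegral_eq_integral_of_forall_compl_eq_zero fun x hx => ?_).symm
    rw [image_eq_zero_of_notMem_tsupport fun hx' => hx (d hx'), zero_smul]
  exact (ae_restrict_iff' measurableSet_Ioo).2 key

namespace MetricGraph

variable {V E : Type*} [Fintype E] (Γ : MetricGraph V E)

/-- The total length `ℒ(Γ)`. -/
def totalLength : ℝ := ∑ e, Γ.length e

/-- The Hilbert space `L²(Γ) = ⨁ₑ L²(0, ℓₑ)` of complex-valued functions. -/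
abbrev L2 : Type _ :=
  PiLp 2 fun e : E => Lp ℂ 2 (volume.restrict (Ioo (0 : ℝ) (Γ.length e)))

/-- The coordinate of an endpoint of the edge `e`. -/
def endpoint (e : E) : Bool → ℝ
  | false => 0
  | true => Γ.length e

/-- The derivative at an endpoint of the edge `e`, taken in the direction pointing into the edge;
`φ'` is the derivative with respect to the coordinate of each edge. -/
def inwardDeriv (φ' : E → ℝ → ℂ) (e : E) : Bool → ℂ
  | false => φ' e 0
  | true => -φ' e (Γ.length e)

/-- The `δ`-type vertex conditions with strengths `α`: continuity at every vertex `v` (with common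
value `c v`), and the inward derivatives at the endpoints in `v` sum up to `α v * c v`. A loop at
`v` contributes both of its endpoints. -/
def DeltaConditions (α : V → ℝ) (φ φ' : E → ℝ → ℂ) : Prop :=
  ∃ c : V → ℂ, (∀ e b, φ e (Γ.endpoint e b) = c (Γ.vertex e b)) ∧
    ∀ v, ∑ᶠ p ∈ {p : E × Bool | Γ.vertex p.1 p.2 = v}, Γ.inwardDeriv φ' p.1 p.2 = (α v : ℂ) * c v

/-- `u` lies in the domain of the `δ`-Laplacian and is mapped to `w`: on each edge `u` is in
`H²(0, ℓₑ)` and `-u'' = w`, with weak derivatives, and `u` satisfies the vertex conditions.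
The functions `φ` and `φ'` are the representatives of `u` and `u'` that are continuous up to the
endpoints, so that their values there are the limiting values. -/
def IsDeltaLaplacian (α : V → ℝ) (u w : Γ.L2) : Prop :=
  ∃ φ φ' : E → ℝ → ℂ,
    (∀ e, u e =ᵐ[volume.restrict (Ioo 0 (Γ.length e))] φ e ∧
      ContinuousOn (φ e) (Icc 0 (Γ.length e)) ∧ ContinuousOn (φ' e) (Icc 0 (Γ.length e)) ∧
      HasWeakDeriv (Γ.length e) (φ e) (φ' e) ∧
      HasWeakDeriv (Γ.length e) (φ' e) (fun x => -(w e x))) ∧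
    Γ.DeltaConditions α φ φ'

/-- The graph of the operator `-d²/dx²` with `δ`-type vertex conditions. -/
def deltaGraph (α : V → ℝ) : Submodule ℂ (Γ.L2 × Γ.L2) where
  carrier := {p | Γ.IsDeltaLaplacian α p.1 p.2}
  zero_mem' := by
    refine ⟨0, 0, fun e => ⟨?_, continuousOn_const, continuousOn_const, HasWeakDeriv.zero _, ?_⟩,
      0, ?_, ?_⟩
    · exact Lp.coeFn_zero _ _ _
    · refine (HasWeakDeriv.zero _).congr ?_
      have h := Lp.coeFn_zero ℂ 2 (volume.restrict (Ioo (0 : ℝ) (Γ.length e)))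
      filter_upwards [h] with x hx
      simpa using hx
    · intro e b
      rfl
    · intro v
      have : ∀ p : E × Bool, Γ.inwardDeriv 0 p.1 p.2 = 0 := by
        rintro ⟨e, _ | _⟩ <;> simp [inwardDeriv]
      simp [this]
  add_mem' := by
    rintro ⟨u, w⟩ ⟨u₁, w₁⟩ ⟨φ, φ', h, c, hc, hs⟩ ⟨ψ, ψ', k, d, hd, ht⟩
    refine ⟨φ + ψ, φ' + ψ', fun e => ?_, c + d, ?_, ?_⟩
    · obtain ⟨h1, h2, h3, h4, h5⟩ := h e
      obtain ⟨k1, k2, k3, k4, k5⟩ := k e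
      refine ⟨(Lp.coeFn_add _ _).trans (h1.add k1), h2.add k2, h3.add k3, h4.add k4,
        (h5.add k5).congr ?_⟩
      filter_upwards [Lp.coeFn_add (w e) (w₁ e)] with x hx
      simp only [Prod.mk_add_mk, PiLp.add_apply, Pi.add_apply] at hx ⊢
      rw [hx]
      ring
    · intro e b
      simp [hc, hd]
    · intro v
      have : ∀ p : E × Bool, Γ.inwardDeriv (φ' + ψ') p.1 p.2 =
          Γ.inwardDeriv φ' p.1 p.2 + Γ.inwardDeriv ψ' p.1 p.2 := by
        rintro ⟨e, _ | _⟩ <;> simp [inwardDeriv]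
        ring
      simp only [this]
      rw [finsum_mem_add_distrib (Set.toFinite _), hs, ht, Pi.add_apply, mul_add]
  smul_mem' := by
    rintro a ⟨u, w⟩ ⟨φ, φ', h, c, hc, hs⟩
    refine ⟨a • φ, a • φ', fun e => ?_, a • c, ?_, ?_⟩
    · obtain ⟨h1, h2, h3, h4, h5⟩ := h e
      refine ⟨(Lp.coeFn_smul _ _).trans (h1.const_smul a), h2.const_smul a, h3.const_smul a,
        h4.smul a, (h5.smul a).congr ?_⟩
      filter_upwards [Lp.coeFn_smul a (w e)] with x hx
      simp only [Prod.smul_mk, PiLp.smul_apply, Pi.smul_apply] at hx ⊢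
      rw [hx, smul_neg]
    · intro e b
      simp [hc]
    · intro v
      have : ∀ p : E × Bool, Γ.inwardDeriv (a • φ') p.1 p.2 =
          a • Γ.inwardDeriv φ' p.1 p.2 := by
        rintro ⟨e, _ | _⟩ <;> simp [inwardDeriv]
      simp only [this]
      rw [← smul_finsum_mem (Set.toFinite _), hs]
      simp only [Pi.smul_apply, smul_eq_mul]
      ring

theorem mem_deltaGraph {α : V → ℝ} {p : Γ.L2 × Γ.L2} :
    p ∈ Γ.deltaGraph α ↔ Γ.IsDeltaLaplacian α p.1 p.2 := Iff.rfl

theorem deltaGraph_functional (α : V → ℝ) (p : Γ.L2 × Γ.L2) (hp : p ∈ Γ.deltaGraph α)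
    (h0 : p.1 = 0) : p.2 = 0 := by
  obtain ⟨φ, φ', h, -⟩ := hp
  ext1 e
  obtain ⟨h1, -, -, h4, h5⟩ := h e
  have hφ : φ e =ᵐ[volume.restrict (Ioo 0 (Γ.length e))] 0 := by
    refine h1.symm.trans ?_
    rw [h0]
    exact Lp.coeFn_zero _ _ _
  have hw := h5.eq_zero (h4.eq_zero hφ)
  refine (Lp.eq_zero_iff_ae_eq_zero).2 ?_
  filter_upwards [hw] with x hx
  simpa using hx

/-- The operator `L = -d²/dx²` in `L²(Γ)` with `δ`-type vertex conditions of strengths `α`. -/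
def deltaLaplacian (α : V → ℝ) : Γ.L2 →ₗ.[ℂ] Γ.L2 := (Γ.deltaGraph α).toLinearPMap

theorem deltaLaplacian_graph (α : V → ℝ) : (Γ.deltaLaplacian α).graph = Γ.deltaGraph α :=
  Submodule.toLinearPMap_graph_eq _ (Γ.deltaGraph_functional α)

/-- The eigenspace `ker (L - μ)`, as a subspace of `L²(Γ)`. -/
def eigenspace (α : V → ℝ) (μ : ℝ) : Submodule ℂ Γ.L2 :=
  (Γ.deltaLaplacian α).graph.comap (LinearMap.prod LinearMap.id ((μ : ℂ) • LinearMap.id))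

theorem mem_eigenspace {α : V → ℝ} {μ : ℝ} {u : Γ.L2} :
    u ∈ Γ.eigenspace α μ ↔
      ∃ h : u ∈ (Γ.deltaLaplacian α).domain, Γ.deltaLaplacian α ⟨u, h⟩ = (μ : ℂ) • u := by
  rw [eigenspace, Submodule.mem_comap, LinearPMap.mem_graph_iff]
  constructor
  · rintro ⟨⟨x, hx⟩, rfl, h⟩
    exact ⟨hx, h⟩
  · rintro ⟨h, e⟩
    exact ⟨⟨u, h⟩, rfl, e⟩

/-- `lam 0 ≤ lam 1 ≤ lam 2 ≤ ⋯` are the eigenvalues of the `δ`-Laplacian, each repeated according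
to its multiplicity: the number of indices `k` with `lam k = μ` is the dimension of the eigenspace
of `μ`, for every real `μ`. -/
structure IsEigenvalueSequence (α : V → ℝ) (lam : ℕ → ℝ) : Prop where
  monotone : Monotone lam
  finite_mult : ∀ μ, Module.Finite ℂ (Γ.eigenspace α μ) ∧ {k | lam k = μ}.Finite
  card_eq : ∀ μ, {k | lam k = μ}.ncard = Module.finrank ℂ (Γ.eigenspace α μ)

end MetricGraph

end

/-! Everything is eigenvalue counting for the quadratic form `∑ ∫ |u'|² + ∑ α_v |u(v)|²` on the H¹
functions that are continuous at the vertices. Functions vanishing at every vertex do not see the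
strengths `α`, and both directions come from such functions.

Upper bound. With `s = (k + |E|)π/ℒ`, extending Dirichlet eigenfunctions of single edges by zero
gives a test space on which the form is at most `s²`, of dimension `∑ ⌊sℓ_e/π⌋ > sℒ/π - |E| = k`. So
at least `k + 1` eigenvalues are at most `s²` (`exists_dirichlet_testSpace`, `le_sq`).

Lower bound. Require `u` to vanish at all vertices and at `⌊cℓ_e/π⌋` equidistant interior points of
each edge. Wirtinger's inequality on the pieces bounds the form below by `c²`, up to a strictness
margin, at the price of `|V| + ∑ ⌊cℓ_e/π⌋ ≤ |V| + cℒ/π` linear conditions. Taking `c` to be the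
square root of `λ_k` gives `k + 1 ≤ |V| + cℒ/π`, which settles `k ≥ |V|` for every `α`
(`sq_le_of_card_le`). The sign of `∑ α_v` matters only at `k = |V| - 1`, where the claim is `λ_k ≥
0`: if the sum is nonnegative, some `α_v` is nonnegative, and vanishing at the vertices with
negative strength costs at most `|V| - 1` conditions and makes the form nonnegative
(`nonneg_of_card_le`).

Counting is done without unbounded operators. The form domain is a Hilbert space of pairs (vertex
values, derivative), the form is a bounded self-adjoint operator `A`, and the embedding `J` into
`L²` is compact; eigenvectors solve `A u = μ J*J u`. The two halves of min–max are
`sum_finrank_formEigenspace_le` and `le_sum_finrank_formEigenspace`, and `mem_eigenspace_iff_exists`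
identifies these weak eigenvectors with the eigenfunctions of the operator. -/

noncomputable section

/-! ### Min–max counting for a form relative to a compact embedding -/

section FormPencil

open scoped InnerProductSpace
open ContinuousLinearMap Module

variable {H K : Type*} [NormedAddCommGroup H] [InnerProductSpace ℂ H] [CompleteSpace H]
  [NormedAddCommGroup K] [InnerProductSpace ℂ K] [CompleteSpace K]

/-- The solutions of `A u = μ J* J u`: the weak eigenvectors, for the eigenvalue `μ`, of the
quadratic form `⟪A u, u⟫` relative to `‖J u‖²`. -/
def formEigenspace (A : H →L[ℂ] H) (J : H →L[ℂ] K) (μ : ℝ) : Submodule ℂ H :=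
  LinearMap.ker (A - (μ : ℂ) • (adjoint J ∘L J)).toLinearMap

variable {A : H →L[ℂ] H} {J : H →L[ℂ] K}

theorem mem_formEigenspace {μ : ℝ} {u : H} :
    u ∈ formEigenspace A J μ ↔ A u = (μ : ℂ) • adjoint J (J u) := by
  simp [formEigenspace, LinearMap.mem_ker, sub_eq_zero]

theorem mem_formEigenspace_iff_inner {μ : ℝ} {u : H} :
    u ∈ formEigenspace A J μ ↔ ∀ v, ⟪A u, v⟫_ℂ = μ * ⟪J u, J v⟫_ℂ := by
  rw [mem_formEigenspace]
  constructor
  · intro h v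
    rw [h, inner_smul_left, adjoint_inner_left, Complex.conj_ofReal]
  · intro h
    refine ext_inner_right ℂ fun v => ?_
    rw [h, inner_smul_left, adjoint_inner_left, Complex.conj_ofReal]

/-- By symmetry of `A`, the number `⟪A u, v⟫` equals both `μ` and `ν` times the same pairing `⟪J u,
J v⟫`. -/
theorem formEigenspace_inner_eq_zero (hA : IsSelfAdjoint A) {μ ν : ℝ} (hne : μ ≠ ν) {u v : H}
    (hu : u ∈ formEigenspace A J μ) (hv : v ∈ formEigenspace A J ν) : ⟪J u, J v⟫_ℂ = 0 := by
  have h1 := mem_formEigenspace_iff_inner.1 hu v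
  have h2 := mem_formEigenspace_iff_inner.1 hv u
  have h3 : ⟪A u, v⟫_ℂ = ⟪u, A v⟫_ℂ := hA.isSymmetric u v
  have h4 : ⟪u, A v⟫_ℂ = ν * ⟪J u, J v⟫_ℂ := by
    rw [← inner_conj_symm, h2, map_mul, inner_conj_symm, Complex.conj_ofReal]
  have h5 : ((μ - ν : ℝ) : ℂ) * ⟪J u, J v⟫_ℂ = 0 := by
    push_cast
    rw [sub_mul, ← h1, ← h4, h3, sub_self]
  rcases mul_eq_zero.1 h5 with h | h
  · exact absurd (by exact_mod_cast h) (sub_ne_zero.2 hne)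
  · exact h

theorem norm_sq_sum_formEigenspace (hA : IsSelfAdjoint A) (S : Finset ℝ)
    (x : ∀ μ : S, formEigenspace A J μ) :
    ‖J (∑ μ, (x μ : H))‖ ^ 2 = ∑ μ, ‖J (x μ)‖ ^ 2 := by
  have h : (⟪J (∑ μ, (x μ : H)), J (∑ μ, (x μ : H))⟫_ℂ) = ∑ μ, ((‖J (x μ)‖ ^ 2 : ℝ) : ℂ) := by
    simp only [map_sum, sum_inner, inner_sum]
    refine Finset.sum_congr rfl fun μ _ => ?_
    rw [Finset.sum_eq_single μ]
    · rw [inner_self_eq_norm_sq_to_K]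
      push_cast
      rfl
    · intro ν _ hne
      exact formEigenspace_inner_eq_zero hA (fun h => hne (Subtype.ext h)) (x ν).2 (x μ).2
    · simp
  rw [inner_self_eq_norm_sq_to_K, ← Complex.ofReal_sum] at h
  exact Complex.ofReal_injective ((Complex.ofReal_pow _ _).trans h)

/-- The cross terms vanish by `J`-orthogonality, so the form is diagonal on sums of eigenvectors,
with weights `μ`. -/
theorem re_inner_sum_formEigenspace (hA : IsSelfAdjoint A) (S : Finset ℝ)
    (x : ∀ μ : S, formEigenspace A J μ) :
    (⟪A (∑ μ, (x μ : H)), ∑ μ, (x μ : H)⟫_ℂ).re = ∑ μ : S, (μ : ℝ) * ‖J (x μ)‖ ^ 2 := by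
  have h : ⟪A (∑ μ, (x μ : H)), ∑ μ, (x μ : H)⟫_ℂ =
      ∑ μ : S, (((μ : ℝ) * ‖J (x μ)‖ ^ 2 : ℝ) : ℂ) := by
    simp only [map_sum, sum_inner, inner_sum]
    refine Finset.sum_congr rfl fun μ _ => ?_
    rw [Finset.sum_eq_single μ]
    · rw [mem_formEigenspace_iff_inner.1 (x μ).2, inner_self_eq_norm_sq_to_K]
      push_cast
      rfl
    · intro ν _ hne
      rw [mem_formEigenspace_iff_inner.1 (x ν).2,
        formEigenspace_inner_eq_zero hA (fun h => hne (Subtype.ext h)) (x ν).2 (x μ).2,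
        mul_zero]
    · simp
  rw [h, ← Complex.ofReal_sum, Complex.ofReal_re]

variable {κ δ : ℝ}

/-- On an eigenvector the form equals `μ ‖J u‖²`, so coercivity leaves `δ ‖u‖² ≤ 0`. Hence `J` loses
no multiplicity. -/
theorem formEigenspace_eq_zero_of_map_eq_zero (hδ : 0 < δ)
    (hco : ∀ u, δ * ‖u‖ ^ 2 ≤ (⟪A u, u⟫_ℂ).re + κ * ‖J u‖ ^ 2) {μ : ℝ} {u : H}
    (hu : u ∈ formEigenspace A J μ) (h : J u = 0) : u = 0 := by
  have h1 := hco u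
  rw [mem_formEigenspace_iff_inner.1 hu, h] at h1
  simp only [inner_zero_left, mul_zero, Complex.zero_re, norm_zero, ne_eq, OfNat.ofNat_ne_zero,
    not_false_eq_true, zero_pow, add_zero] at h1
  have h2 : ‖u‖ ^ 2 ≤ 0 := by
    by_contra! h3
    nlinarith
  simpa using le_antisymm h2 (sq_nonneg _)

/-- If the form exceeds `Λ` on the kernel of a linear map to `P`, then the eigenvalues up to `Λ`
have total multiplicity at most `dim P`. -/
theorem sum_finrank_formEigenspace_le (hA : IsSelfAdjoint A) (hδ : 0 < δ)
    (hco : ∀ u, δ * ‖u‖ ^ 2 ≤ (⟪A u, u⟫_ℂ).re + κ * ‖J u‖ ^ 2)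
    {P : Type*} [AddCommGroup P] [Module ℂ P] [FiniteDimensional ℂ P] (L : H →ₗ[ℂ] P) {Λ : ℝ}
    (hL : ∀ u, L u = 0 → u ≠ 0 → Λ * ‖J u‖ ^ 2 < (⟪A u, u⟫_ℂ).re)
    (S : Finset ℝ) (hS : ∀ μ ∈ S, μ ≤ Λ) :
    (∀ μ ∈ S, FiniteDimensional ℂ (formEigenspace A J μ)) ∧
      ∑ μ ∈ S, finrank ℂ (formEigenspace A J μ) ≤ finrank ℂ P := by
  let Φ : (∀ μ : S, formEigenspace A J μ) →ₗ[ℂ] H :=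
    ∑ μ : S, (formEigenspace A J (μ : ℝ)).subtype ∘ₗ LinearMap.proj μ
  have hΦ : ∀ x, Φ x = ∑ μ, (x μ : H) := fun x => by simp [Φ]
  -- On the range of `Φ` the form is at most `Λ ‖J ·‖²`, which `hL` forbids for nonzero vectors
  -- killed by `L`. Then `J`-orthogonality makes every summand of the zero sum vanish.
  have hinj : Function.Injective (L ∘ₗ Φ) := by
    rw [← LinearMap.ker_eq_bot, LinearMap.ker_eq_bot']
    intro x hx
    have h0 : Φ x = 0 := by
      by_contra hne
      have h1 := hL _ hx hne
      rw [hΦ, re_inner_sum_formEigenspace hA, norm_sq_sum_formEigenspace hA, Finset.mul_sum] at h1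
      refine absurd h1 (not_lt.2 (Finset.sum_le_sum fun μ _ => ?_))
      exact mul_le_mul_of_nonneg_right (hS μ μ.2) (sq_nonneg _)
    have h2 := norm_sq_sum_formEigenspace hA S x
    rw [← hΦ, h0, map_zero, norm_zero, zero_pow two_ne_zero, eq_comm,
      Finset.sum_eq_zero_iff_of_nonneg fun _ _ => sq_nonneg _] at h2
    funext μ
    have h3 : J (x μ) = 0 := by simpa using h2 μ (Finset.mem_univ _)
    exact Subtype.ext (formEigenspace_eq_zero_of_map_eq_zero hδ hco (x μ).2 h3)
  have hfin : ∀ μ ∈ S, FiniteDimensional ℂ (formEigenspace A J μ) := by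
    classical
    intro μ hμ
    refine FiniteDimensional.of_injective
      ((L ∘ₗ Φ) ∘ₗ LinearMap.single ℂ (fun μ : S => formEigenspace A J μ) ⟨μ, hμ⟩) ?_
    intro a b hab
    have h1 := congrFun (hinj hab) ⟨μ, hμ⟩
    simpa only [LinearMap.coe_single, Pi.single_eq_same] using h1
  refine ⟨hfin, ?_⟩
  have : ∀ μ : S, FiniteDimensional ℂ (formEigenspace A J μ) := fun μ => hfin μ μ.2
  have h := LinearMap.finrank_le_finrank_of_injective hinj
  rw [Module.finrank_pi_fintype] at h
  rwa [← Finset.sum_coe_sort]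

/-- The Rayleigh quotient of a nonnegative compact self-adjoint operator is at most `r` on the
orthogonal complement of the eigenspaces with eigenvalue at least `r`. -/
theorem re_inner_le_of_orthogonal_eigenspaces {T : K →L[ℂ] K} (hT : IsCompactOperator T)
    (hs : (T : K →ₗ[ℂ] K).IsSymmetric) (hp : ∀ x, 0 ≤ (⟪x, T x⟫_ℂ).re) {r : ℝ} (hr : 0 ≤ r) {f : K}
    (hf : ∀ ν : ℝ, r ≤ ν → ∀ x, T x = (ν : ℂ) • x → ⟪x, f⟫_ℂ = 0) :
    (⟪f, T f⟫_ℂ).re ≤ r * ‖f‖ ^ 2 := by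
  let M : Submodule ℂ K := ⨅ ν : Set.Ici r, (End.eigenspace (T : End ℂ K) ((ν : ℝ) : ℂ))ᗮ
  have hM : ∀ {g : K}, g ∈ M ↔ ∀ ν : ℝ, r ≤ ν → ∀ x, T x = (ν : ℂ) • x → ⟪x, g⟫_ℂ = 0 := by
    intro g
    simp [M, Submodule.mem_iInf, Submodule.mem_orthogonal]
  have hMc : IsClosed (M : Set K) := by
    simp only [M, Submodule.coe_iInf]
    exact isClosed_iInter fun ν => Submodule.isClosed_orthogonal _
  have : CompleteSpace M := hMc.completeSpace_coe
  have hinv : ∀ g ∈ M, (T : K →ₗ[ℂ] K) g ∈ M := by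
    intro g hg
    rw [hM] at hg ⊢
    intro ν hν x hx
    have := hs x g
    simp only [ContinuousLinearMap.coe_coe] at this ⊢
    rw [← this, hx, inner_smul_left, hg ν hν x hx, mul_zero]
  let S : M →L[ℂ] M := T.restrict hinv
  have hSc : IsCompactOperator S := hT.restrict' hinv
  have hSs : (S : M →ₗ[ℂ] M).IsSymmetric := hs.restrict_invariant hinv
  -- A self-adjoint operator has norm equal to its spectral radius, and the nonzero spectrum of a
  -- compact one consists of eigenvalues. An eigenvector in `M` with eigenvalue above `r` would be
  -- orthogonal to itself.
  have hnorm : ‖S‖ ≤ r := by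
    have h1 := S.spectralRadius_eq_nnnorm hSs.isSelfAdjoint
    have h2 : spectralRadius ℂ S ≤ ENNReal.ofReal r := by
      refine iSup₂_le fun ν hν => ?_
      by_cases h0 : ν = 0
      · simp [h0]
      have h3 := (hSc.hasEigenvalue_iff_mem_spectrum h0).2 hν
      have h4 := hSs.conj_eigenvalue_eq_self h3
      obtain ⟨ρ, rfl⟩ := Complex.conj_eq_iff_real.1 h4
      obtain ⟨x, hx1, hx0⟩ := h3.exists_hasEigenvector
      rw [End.mem_eigenspace_iff] at hx1
      have hx2 : T (x : K) = (ρ : ℂ) • (x : K) := congrArg Subtype.val hx1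
      have hx0' : (x : K) ≠ 0 := fun h => hx0 (Subtype.ext h)
      have hnn : 0 ≤ ρ := by
        have := hp x
        rw [hx2, inner_smul_right, inner_self_eq_norm_sq_to_K] at this
        have h5 : ((ρ : ℂ) * ((‖(x : K)‖ : ℂ)) ^ 2).re = ρ * ‖(x : K)‖ ^ 2 := by
          rw [← Complex.ofReal_pow, ← Complex.ofReal_mul, Complex.ofReal_re]
        have h6 : 0 ≤ ρ * ‖(x : K)‖ ^ 2 := by
          rw [← h5]; exact this
        have h7 : 0 < ‖(x : K)‖ ^ 2 := by positivity
        exact nonneg_of_mul_nonneg_left h6 h7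
      have hlt : ρ ≤ r := by
        by_contra! hgt
        exact hx0' (inner_self_eq_zero.1 (hM.1 x.2 ρ hgt.le x hx2))
      rw [← enorm_eq_nnnorm, ← ofReal_norm, Complex.norm_real, Real.norm_of_nonneg hnn]
      exact ENNReal.ofReal_le_ofReal hlt
    rw [h1, ← enorm_eq_nnnorm, ← ofReal_norm] at h2
    exact (ENNReal.ofReal_le_ofReal_iff hr).1 h2
  let g : M := ⟨f, hM.2 hf⟩
  calc (⟪f, T f⟫_ℂ).re ≤ ‖⟪f, T f⟫_ℂ‖ := Complex.re_le_norm _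
    _ = ‖⟪g, S g⟫_ℂ‖ := rfl
    _ ≤ ‖g‖ * ‖S g‖ := norm_inner_le_norm _ _
    _ ≤ ‖g‖ * (r * ‖g‖) := by
        gcongr
        exact (S.le_opNorm g).trans (by gcongr)
    _ = r * ‖f‖ ^ 2 := by
        change ‖f‖ * (r * ‖f‖) = _
        ring

/-- If the form is at most `Λ` on an `m`-dimensional subspace, then the eigenvalues up to any
`Λ' > Λ` have total multiplicity at least `m`. -/
theorem le_sum_finrank_formEigenspace (hA : IsSelfAdjoint A) (hJ : IsCompactOperator J)
    (hδ : 0 < δ) (hco : ∀ u, δ * ‖u‖ ^ 2 ≤ (⟪A u, u⟫_ℂ).re + κ * ‖J u‖ ^ 2)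
    {P : Type*} [AddCommGroup P] [Module ℂ P] [FiniteDimensional ℂ P] (Ψ : P →ₗ[ℂ] H)
    (hΨ : Function.Injective Ψ) {Λ Λ' : ℝ} (hΛ : Λ < Λ')
    (hle : ∀ p, (⟪A (Ψ p), Ψ p⟫_ℂ).re ≤ Λ * ‖J (Ψ p)‖ ^ 2)
    (S : Finset ℝ) (hS : ∀ μ ≤ Λ', formEigenspace A J μ ≠ ⊥ → μ ∈ S)
    (hfin : ∀ μ ∈ S, FiniteDimensional ℂ (formEigenspace A J μ)) :
    finrank ℂ P ≤ ∑ μ ∈ S, finrank ℂ (formEigenspace A J μ) := by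
  by_contra! hlt
  have : ∀ μ : S, FiniteDimensional ℂ (formEigenspace A J μ) := fun μ => hfin μ μ.2
  have : ∀ μ : S, CompleteSpace (formEigenspace A J μ) := fun μ => FiniteDimensional.complete ℂ _
  -- `Q p = 0` says that `J (Ψ p)` is orthogonal to the `J`-images of all the eigenspaces; if these
  -- are too small in total, some nonzero `p` satisfies it.
  let Q : P →ₗ[ℂ] (∀ μ : S, formEigenspace A J μ) := LinearMap.pi fun μ =>
    (adjoint (J ∘L (formEigenspace A J μ).subtypeL) : K →ₗ[ℂ] formEigenspace A J μ) ∘ₗ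
      (J : H →ₗ[ℂ] K) ∘ₗ Ψ
  have hker : LinearMap.ker Q ≠ ⊥ := by
    refine LinearMap.ker_ne_bot_of_finrank_lt ?_
    rw [Module.finrank_pi_fintype]
    rwa [← Finset.sum_coe_sort] at hlt
  obtain ⟨p, hp, hp0⟩ := Submodule.exists_mem_ne_zero_of_ne_bot hker
  set w := Ψ p with hw
  have hw0 : w ≠ 0 := fun h => hp0 (hΨ (by rw [← hw, h, map_zero]))
  have hcomp : ∀ μ ∈ S, CompleteSpace (formEigenspace A J μ) := fun μ hμ =>
    have := hfin μ hμ
    FiniteDimensional.complete ℂ _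
  have horth : ∀ μ ∈ S, ∀ x ∈ formEigenspace A J μ, ⟪J x, J w⟫_ℂ = 0 := by
    intro μ hμ x hx
    have := hcomp μ hμ
    have h1 : adjoint (J ∘L (formEigenspace A J μ).subtypeL) (J w) = 0 :=
      congrFun (LinearMap.mem_ker.1 hp) ⟨μ, hμ⟩
    have h2 := adjoint_inner_right (J ∘L (formEigenspace A J μ).subtypeL) ⟨x, hx⟩ (J w)
    rw [h1, inner_zero_right] at h2
    exact h2.symm
  have hwpos : 0 < ‖w‖ ^ 2 := by positivity
  have h1 := hco w
  have h2 := hle p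
  rw [← hw] at h2
  -- Coercivity against the upper bound `hle`; both `J w ≠ 0` and `Λ + κ > 0` follow.
  have h3 : 0 < (Λ + κ) * ‖J w‖ ^ 2 := by nlinarith [mul_pos hδ hwpos]
  have hJw : 0 < ‖J w‖ ^ 2 := by
    rcases (sq_nonneg ‖J w‖).eq_or_lt with h | h
    · rw [← h, mul_zero] at h3
      exact absurd h3 (lt_irrefl _)
    · exact h
  have hs : 0 < Λ + κ := pos_of_mul_pos_left h3 hJw.le
  set s := Λ' + κ with hsdef
  have hs' : 0 < s := by linarith
  let B : H →L[ℂ] H := A + (κ : ℂ) • (adjoint J ∘L J)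
  have hB : ∀ u, B u = A u + (κ : ℂ) • adjoint J (J u) := fun u => by simp [B]
  have hBre : ∀ u, (⟪B u, u⟫_ℂ).re = (⟪A u, u⟫_ℂ).re + κ * ‖J u‖ ^ 2 := by
    intro u
    rw [hB, inner_add_left, inner_smul_left, adjoint_inner_left, Complex.conj_ofReal,
      inner_self_eq_norm_sq_to_K, Complex.add_re]
    congr 1
    change ((κ : ℂ) * ((‖J u‖ : ℝ) : ℂ) ^ 2).re = _
    rw [← Complex.ofReal_pow, ← Complex.ofReal_mul, Complex.ofReal_re]
  have hBsa : IsSelfAdjoint B := by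
    refine hA.add ?_
    rw [ContinuousLinearMap.isSelfAdjoint_iff_isSymmetric]
    intro x y
    simp only [ContinuousLinearMap.coe_coe, smul_apply,
      ContinuousLinearMap.comp_apply, inner_smul_left, inner_smul_right, adjoint_inner_left,
      adjoint_inner_right, Complex.conj_ofReal]
  have hBu : IsUnit B := by
    refine isUnit_of_forall_le_norm_inner_map B (c := ⟨δ, hδ.le⟩) hδ fun x => ?_
    calc ‖x‖ ^ 2 * δ ≤ (⟪B x, x⟫_ℂ).re := by rw [hBre, mul_comm]; exact hco x
      _ ≤ _ := Complex.re_le_norm _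
  obtain ⟨⟨B, R, hBR, hRB⟩, hBeq⟩ := hBu
  simp only at hBeq
  subst hBeq
  have hBRx : ∀ x, (A + (κ : ℂ) • (adjoint J ∘L J) : H →L[ℂ] H) (R x) = x := fun x =>
    DFunLike.congr_fun hBR x
  have hRs : ∀ x y, ⟪R x, y⟫_ℂ = ⟪x, R y⟫_ℂ := by
    intro x y
    conv_lhs => rw [← hBRx y]
    conv_rhs => rw [← hBRx x]
    exact (hBsa.isSymmetric (R x) (R y)).symm
  have hRp : ∀ x, 0 ≤ (⟪x, R x⟫_ℂ).re := by
    intro x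
    have h4 : (⟪(A + (κ : ℂ) • (adjoint J ∘L J) : H →L[ℂ] H) (R x), R x⟫_ℂ).re = _ := hBre (R x)
    rw [hBRx] at h4
    rw [h4]
    exact (by positivity : (0 : ℝ) ≤ _).trans (hco (R x))
  -- Here `R` inverts `A + κ J*J`. If `T x = ν x` with `ν > 0`, then `R J* x` is an eigenvector of
  -- the pencil for `ν⁻¹ - κ`, and `ν ≥ s⁻¹` becomes `ν⁻¹ - κ ≤ Λ'`. So `J w` is orthogonal to all
  -- eigenvectors of `T` with eigenvalue at least `s⁻¹`.
  let T : K →L[ℂ] K := J ∘L R ∘L adjoint J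
  have hTc : IsCompactOperator T := hJ.comp_clm (R ∘L adjoint J)
  have hTs : (T : K →ₗ[ℂ] K).IsSymmetric := by
    intro x y
    change ⟪J (R (adjoint J x)), y⟫_ℂ = ⟪x, J (R (adjoint J y))⟫_ℂ
    rw [← adjoint_inner_right J, ← adjoint_inner_left J, hRs]
  have hTp : ∀ x, (⟪x, T x⟫_ℂ) = ⟪adjoint J x, R (adjoint J x)⟫_ℂ := by
    intro x
    change ⟪x, J (R (adjoint J x))⟫_ℂ = _
    rw [← adjoint_inner_left J]
  have hray := re_inner_le_of_orthogonal_eigenspaces hTc hTs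
    (fun x => by rw [hTp]; exact hRp _) (inv_nonneg.2 hs'.le) (f := J w) (by
      intro ν hν x hx
      have hνpos : 0 < ν := (inv_pos.2 hs').trans_le hν
      set y := R (adjoint J x)
      have hy : J y = (ν : ℂ) • x := hx
      have hx' : x = ((ν⁻¹ : ℝ) : ℂ) • J y := by
        rw [hy, smul_smul, ← Complex.ofReal_mul, inv_mul_cancel₀ hνpos.ne', Complex.ofReal_one,
          one_smul]
      have hyE : y ∈ formEigenspace A J (ν⁻¹ - κ) := by
        rw [mem_formEigenspace]
        have h4 : A y + (κ : ℂ) • adjoint J (J y) = adjoint J x := by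
          rw [← hBRx (adjoint J x), hB]
        have h5 : adjoint J x = ((ν⁻¹ : ℝ) : ℂ) • adjoint J (J y) := by
          conv_lhs => rw [hx', map_smul]
        rw [Complex.ofReal_sub, sub_smul, ← h5, ← h4]
        abel
      have hle' : ν⁻¹ - κ ≤ Λ' := by
        have : ν⁻¹ ≤ s := inv_le_of_inv_le₀ hs' hν
        linarith
      rw [hx', inner_smul_left]
      by_cases hy0 : y = 0
      · simp [hy0]
      rw [horth _ (hS _ hle' fun h => hy0 (by rw [h] at hyE; exact hyE)) y hyE, mul_zero])
  -- Positivity of the shifted operator `B` at `w - s R J* J w` reads `⟪B w, w⟫ - 2s ‖J w‖² + s² ⟪J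
  -- w, T J w⟫ ≥ 0`. With the bound on `T` this gives `⟪B w, w⟫ ≥ s ‖J w‖²`, contradicting `⟪B w, w⟫
  -- ≤ (Λ + κ) ‖J w‖²` and `Λ + κ < s`.
  have hfinal : 0 ≤ (⟪(A + (κ : ℂ) • (adjoint J ∘L J) : H →L[ℂ] H)
      (w - (s : ℂ) • R (adjoint J (J w))), w - (s : ℂ) • R (adjoint J (J w))⟫_ℂ).re := by
    refine le_trans ?_ ((hco _).trans (hBre _).ge)
    positivity
  set b := adjoint J (J w)
  have e1 : ⟪(A + (κ : ℂ) • (adjoint J ∘L J) : H →L[ℂ] H) w, R b⟫_ℂ = ((‖J w‖ ^ 2 : ℝ) : ℂ) := by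
    have h4 : ⟪(A + (κ : ℂ) • (adjoint J ∘L J) : H →L[ℂ] H) w, R b⟫_ℂ =
      ⟪w, (A + (κ : ℂ) • (adjoint J ∘L J) : H →L[ℂ] H) (R b)⟫_ℂ := hBsa.isSymmetric w (R b)
    rw [h4, hBRx, adjoint_inner_right, inner_self_eq_norm_sq_to_K]
    push_cast
    rfl
  have e2 : ⟪b, w⟫_ℂ = ((‖J w‖ ^ 2 : ℝ) : ℂ) := by
    rw [adjoint_inner_left, inner_self_eq_norm_sq_to_K]
    push_cast
    rfl
  rw [map_sub, map_smul, hBRx, inner_sub_left, inner_sub_right, inner_sub_right,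
    inner_smul_left, inner_smul_left, inner_smul_right, inner_smul_right, e1, e2,
    Complex.conj_ofReal, ← hTp] at hfinal
  simp only [Complex.sub_re, Complex.re_ofReal_mul, Complex.ofReal_re] at hfinal
  rw [show (⟪(A + (κ : ℂ) • (adjoint J ∘L J) : H →L[ℂ] H) w, w⟫_ℂ).re = _ from hBre w] at hfinal
  have h6 : s * (s * (⟪J w, T (J w)⟫_ℂ).re) ≤ s * ‖J w‖ ^ 2 := by
    refine mul_le_mul_of_nonneg_left ?_ hs'.le
    calc s * (⟪J w, T (J w)⟫_ℂ).re ≤ s * (s⁻¹ * ‖J w‖ ^ 2) :=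
          mul_le_mul_of_nonneg_left hray hs'.le
      _ = ‖J w‖ ^ 2 := by field_simp
  nlinarith

/-- An operator that is arbitrarily small on subspaces of finite codimension is compact. -/
theorem isCompactOperator_of_small_on_ker
    (h : ∀ ε > 0, ∃ (n : ℕ) (L : H →L[ℂ] (Fin n → ℂ)), ∀ u, L u = 0 → ‖J u‖ ≤ ε * ‖u‖) :
    IsCompactOperator J := by
  refine isClosed_setOfPred_isCompactOperator.closure_subset_iff.2 (subset_refl _) ?_
  rw [Metric.mem_closure_iff]
  intro ε hε
  obtain ⟨n, L, hL⟩ := h (ε / 2) (by positivity)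
  let F : Submodule ℂ H := LinearMap.ker L.toLinearMap
  have : CompleteSpace F := L.isClosed_ker.completeSpace_coe
  have hfd : FiniteDimensional ℂ Fᗮ := by
    refine FiniteDimensional.of_injective ((L : H →ₗ[ℂ] (Fin n → ℂ)) ∘ₗ Fᗮ.subtype) ?_
    rw [← LinearMap.ker_eq_bot, LinearMap.ker_eq_bot']
    intro x hx
    have h1 : (x : H) ∈ F := hx
    exact Subtype.ext (inner_self_eq_zero.1 (Submodule.inner_right_of_mem_orthogonal h1 x.2))
  -- This operator has finite rank, and its difference from `J` is `J` after projection to `F = ker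
  -- L`, where `J` is small.
  refine ⟨J ∘L Fᗮ.starProjection, ?_, ?_⟩
  · have h1 : IsCompactOperator (id : Fᗮ → Fᗮ) := isCompactOperator_id_iff_finiteDimensional.2 hfd
    have h2 : IsCompactOperator ((J ∘L Fᗮ.subtypeL) ∘ id) := h1.clm_comp (J ∘L Fᗮ.subtypeL)
    exact h2.comp_clm Fᗮ.orthogonalProjectionOnto
  · rw [dist_eq_norm]
    refine lt_of_le_of_lt (opNorm_le_bound _ (by positivity) fun u => ?_) (half_lt_self hε)
    have h1 : (J - J ∘L Fᗮ.starProjection) u = J (F.starProjection u) := by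
      rw [sub_apply, ContinuousLinearMap.comp_apply, ← map_sub]
      congr 1
      rw [sub_eq_iff_eq_add]
      exact (Submodule.starProjection_add_starProjection_orthogonal u).symm
    rw [h1]
    refine (hL _ (F.starProjection_apply_mem u)).trans ?_
    gcongr
    exact F.norm_starProjection_apply_le u

end FormPencil

/-! ### Listing eigenvalues with multiplicity -/

section Enumeration

variable {D : ℝ → ℕ}

/-- A locally finite multiplicity function on the line with infinite total mass, and finite mass on
each half-line `(-∞, Λ]`, is the multiplicity function of a monotone sequence. -/
theorem exists_monotone_ncard_eq
    (hfin : ∀ Λ, {μ | μ ≤ Λ ∧ D μ ≠ 0}.Finite)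
    (hinf : ∀ m : ℕ, ∃ S : Finset ℝ, m ≤ ∑ μ ∈ S, D μ) :
    ∃ lam : ℕ → ℝ, Monotone lam ∧ ∀ μ, {k | lam k = μ}.Finite ∧ {k | lam k = μ}.ncard = D μ := by
  classical
  have hfin' : ∀ Λ, {μ | μ < Λ ∧ D μ ≠ 0}.Finite := fun Λ =>
    (hfin Λ).subset fun μ hμ => ⟨hμ.1.le, hμ.2⟩
  -- `N` is the mass of `(-∞, Λ]` and `N'` that of `(-∞, Λ)`; they differ by the jump `D Λ`.
  let N : ℝ → ℕ := fun Λ => ∑ μ ∈ (hfin Λ).toFinset, D μ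
  let N' : ℝ → ℕ := fun Λ => ∑ μ ∈ (hfin' Λ).toFinset, D μ
  have hN : Monotone N := fun a b hab => Finset.sum_le_sum_of_subset fun μ hμ => by
    simp only [Set.Finite.mem_toFinset, mem_ofPred_eq] at hμ ⊢
    exact ⟨hμ.1.trans hab, hμ.2⟩
  have hNN' : ∀ {a b}, a < b → N a ≤ N' b := fun hab => Finset.sum_le_sum_of_subset fun μ hμ => by
    simp only [Set.Finite.mem_toFinset, mem_ofPred_eq] at hμ ⊢
    exact ⟨hμ.1.trans_lt hab, hμ.2⟩
  have hstep : ∀ μ, N μ = N' μ + D μ := by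
    intro μ
    by_cases h0 : D μ = 0
    · rw [h0, add_zero]
      refine Finset.sum_congr ?_ fun _ _ => rfl
      ext ν
      simp only [Set.Finite.mem_toFinset, mem_ofPred_eq]
      refine ⟨fun h => ⟨lt_of_le_of_ne h.1 ?_, h.2⟩, fun h => ⟨h.1.le, h.2⟩⟩
      rintro rfl
      exact h.2 h0
    · have : (hfin μ).toFinset = insert μ (hfin' μ).toFinset := by
        ext ν
        simp only [Set.Finite.mem_toFinset, mem_ofPred_eq, Finset.mem_insert]
        constructor
        · rintro ⟨h1, h2⟩
          rcases h1.eq_or_lt with h | h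
          · exact Or.inl h
          · exact Or.inr ⟨h, h2⟩
        · rintro (rfl | h)
          · exact ⟨le_rfl, h0⟩
          · exact ⟨h.1.le, h.2⟩
      simp only [N, N', this]
      rw [Finset.sum_insert (by simp), add_comm]
  -- The `k`-th value is the least `μ` with `k < N μ`. It exists because `N` jumps only at points of
  -- positive mass, finitely many below any level.
  have hex : ∀ k, ∃ μ, D μ ≠ 0 ∧ k < N μ ∧ ∀ Λ, k < N Λ → μ ≤ Λ := by
    intro k
    obtain ⟨S, hS⟩ := hinf (k + 1)
    obtain ⟨Λ, hΛ⟩ : ∃ Λ, k < N Λ := by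
      obtain ⟨Λ, hΛ⟩ := S.finite_toSet.bddAbove
      refine ⟨Λ, (Nat.lt_of_succ_le hS).trans_le ?_⟩
      rw [← Finset.sum_filter_ne_zero]
      refine Finset.sum_le_sum_of_subset fun μ hμ => ?_
      rw [Finset.mem_filter] at hμ
      simpa using ⟨hΛ hμ.1, hμ.2⟩
    have hbelow : ∀ Λ, k < N Λ → ∃ μ, D μ ≠ 0 ∧ k < N μ ∧ μ ≤ Λ := by
      intro Λ hΛ
      have hne : (hfin Λ).toFinset.Nonempty := by
        rw [Finset.nonempty_iff_ne_empty]
        intro h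
        simp only [N, h, Finset.sum_empty] at hΛ
        omega
      have hmem := Finset.max'_mem _ hne
      set ν := (hfin Λ).toFinset.max' hne
      rw [Set.Finite.mem_toFinset] at hmem
      refine ⟨ν, hmem.2, hΛ.trans_le ?_, hmem.1⟩
      refine Finset.sum_le_sum_of_subset fun μ hμ => ?_
      have := Finset.le_max' _ μ hμ
      rw [Set.Finite.mem_toFinset] at hμ ⊢
      exact ⟨this, hμ.2⟩
    obtain ⟨μ₀, h1, h2, h3⟩ := hbelow Λ hΛ
    have hne : ((hfin Λ).toFinset.filter fun μ => k < N μ).Nonempty :=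
      ⟨μ₀, by simpa using ⟨⟨h3, h1⟩, h2⟩⟩
    have hmem := Finset.min'_mem _ hne
    set ν := ((hfin Λ).toFinset.filter fun μ => k < N μ).min' hne
    rw [Finset.mem_filter, Set.Finite.mem_toFinset] at hmem
    refine ⟨ν, hmem.1.2, hmem.2, fun Λ' hΛ' => ?_⟩
    rcases le_total Λ Λ' with h | h
    · exact hmem.1.1.trans h
    · obtain ⟨μ, m1, m2, m3⟩ := hbelow Λ' hΛ'
      refine (Finset.min'_le _ μ ?_).trans m3
      simpa using ⟨⟨m3.trans h, m1⟩, m2⟩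
  choose lam hlam1 hlam2 hlam3 using hex
  refine ⟨lam, fun j k hjk => hlam3 j _ (hjk.trans_lt (hlam2 k)), fun μ => ?_⟩
  have hset : {k | lam k = μ} = Ico (N' μ) (N μ) := by
    ext k
    simp only [mem_ofPred_eq, mem_Ico]
    constructor
    · rintro rfl
      refine ⟨?_, hlam2 k⟩
      by_contra! hlt
      have hne : (hfin' (lam k)).toFinset.Nonempty := by
        rw [Finset.nonempty_iff_ne_empty]
        intro h
        simp only [N', h, Finset.sum_empty] at hlt
        omega
      have hmem := Finset.max'_mem _ hne
      set ν := (hfin' (lam k)).toFinset.max' hne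
      rw [Set.Finite.mem_toFinset] at hmem
      have h1 : N' (lam k) ≤ N ν := by
        refine Finset.sum_le_sum_of_subset fun μ hμ => ?_
        have := Finset.le_max' _ μ hμ
        rw [Set.Finite.mem_toFinset] at hμ ⊢
        exact ⟨this, hμ.2⟩
      exact absurd (hlam3 k ν (hlt.trans_le h1)) (not_le.2 hmem.1)
    · rintro ⟨h1, h2⟩
      refine le_antisymm (hlam3 k μ h2) ?_
      by_contra! hlt
      exact absurd (hlam2 k) (not_lt.2 ((hNN' hlt).trans h1))
  rw [hset]
  refine ⟨finite_Ico _ _, ?_⟩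
  rw [← Nat.card_coe_set_eq, Nat.card_eq_fintype_card, Fintype.card_ofFinset, Nat.card_Ico, hstep,
    Nat.add_sub_cancel_left]

theorem finite_and_ncard_eq_sum {lam : ℕ → ℝ} (hfin : ∀ μ, {k | lam k = μ}.Finite)
    (hcard : ∀ μ, {k | lam k = μ}.ncard = D μ) (S : Finset ℝ) :
    {k | lam k ∈ S}.Finite ∧ {k | lam k ∈ S}.ncard = ∑ μ ∈ S, D μ := by
  classical
  have h1 : {k | lam k ∈ S} = ↑(S.biUnion fun μ => (hfin μ).toFinset) := by
    ext k
    simp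
  rw [h1]
  refine ⟨Finset.finite_toSet _, ?_⟩
  rw [Set.ncard_coe_finset, Finset.card_biUnion]
  · refine Finset.sum_congr rfl fun μ _ => ?_
    rw [← hcard, Set.ncard_eq_toFinset_card _ (hfin μ)]
  · intro μ _ ν _ hne
    rw [Function.onFun, Finset.disjoint_left]
    intro k h1 h2
    simp only [Set.Finite.mem_toFinset, mem_ofPred_eq] at h1 h2
    exact hne (h1.symm.trans h2)

end Enumeration

/-! ### Primitives of integrable functions, Wirtinger and trace inequalities -/

section Primitive

open scoped ComplexConjugate

/-- Lebesgue differentiation is applied to the real and imaginary parts, which are recombined as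
multiples of `1` and `I`. -/
theorem IntervalIntegrable.exists_absolutelyContinuous_primitive {a b : ℝ} (hab : a ≤ b)
    {f : ℝ → ℂ} (hf : IntervalIntegrable f volume a b) :
    ∃ G : ℝ → ℂ, AbsolutelyContinuousOnInterval G a b ∧
      (∀ x ∈ Icc a b, G x = ∫ t in a..x, f t) ∧
      ∀ᵐ x, x ∈ uIcc a b → HasDerivAt G (f x) x := by
  have hconst : ∀ c : ℂ, AbsolutelyContinuousOnInterval (fun _ : ℝ => c) a b := fun c =>
    (LipschitzWith.const c).lipschitzOnWith.absolutelyContinuousOnInterval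
  have hre : IntervalIntegrable (fun x => (f x).re) volume a b := ⟨hf.1.re, hf.2.re⟩
  have him : IntervalIntegrable (fun x => (f x).im) volume a b := ⟨hf.1.im, hf.2.im⟩
  refine ⟨_, ((hre.absolutelyContinuousOnInterval_intervalIntegral left_mem_uIcc).smul
    (hconst 1)).add ((him.absolutelyContinuousOnInterval_intervalIntegral left_mem_uIcc).smul
    (hconst Complex.I)), ?_, ?_⟩
  · intro x hx
    have h1 : IntervalIntegrable f volume a x :=
      hf.mono_set (by rw [uIcc_of_le hx.1, uIcc_of_le hab]; exact Icc_subset_Icc_right hx.2)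
    simp only [Pi.add_apply, Pi.smul_apply', Complex.real_smul, mul_one]
    have h2 : ∫ t in a..x, (f t).re = (∫ t in a..x, f t).re := by
      rw [intervalIntegral.integral_of_le hx.1, intervalIntegral.integral_of_le hx.1]
      exact integral_re h1.1
    have h3 : ∫ t in a..x, (f t).im = (∫ t in a..x, f t).im := by
      rw [intervalIntegral.integral_of_le hx.1, intervalIntegral.integral_of_le hx.1]
      exact integral_im h1.1
    rw [h2, h3, Complex.re_add_im]
  · filter_upwards [hre.ae_hasDerivAt_integral, him.ae_hasDerivAt_integral] with x h1 h2 hx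
    have h3 := (h1 hx a left_mem_uIcc).smul_const (1 : ℂ)
    have h4 := (h2 hx a left_mem_uIcc).smul_const Complex.I
    have h5 := h3.add h4
    simp only [Complex.real_smul, mul_one, Complex.re_add_im] at h5
    refine h5.congr_of_eventuallyEq (Filter.Eventually.of_forall fun y => ?_)
    simp [Complex.real_smul]

/-- `F` is a primitive of the integrable function `f` on `[a, b]`. -/
structure IsPrimitive (a b : ℝ) (F f : ℝ → ℂ) : Prop where
  intervalIntegrable : IntervalIntegrable f volume a b
  eq : ∀ x ∈ Icc a b, F x = F a + ∫ t in a..x, f t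

namespace IsPrimitive

variable {a b : ℝ} {F f G g : ℝ → ℂ}

theorem continuousOn (hab : a ≤ b) (hF : IsPrimitive a b F f) : ContinuousOn F (Icc a b) := by
  have h := intervalIntegral.continuousOn_primitive_interval' hF.intervalIntegrable left_mem_uIcc
  rw [uIcc_of_le hab] at h
  exact (continuousOn_const.add h).congr hF.eq

theorem integral_eq (hab : a ≤ b) (hF : IsPrimitive a b F f) :
    ∫ t in a..b, f t = F b - F a := by
  rw [hF.eq b (right_mem_Icc.2 hab)]
  ring

theorem mono {c d : ℝ} (hF : IsPrimitive a b F f) (hac : a ≤ c) (hcd : c ≤ d) (hdb : d ≤ b) :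
    IsPrimitive c d F f := by
  have hi : ∀ {x y}, a ≤ x → x ≤ y → y ≤ b → IntervalIntegrable f volume x y := fun h1 h2 h3 =>
    hF.intervalIntegrable.mono_set (by
      rw [uIcc_of_le h2, uIcc_of_le (h1.trans (h2.trans h3))]
      exact Icc_subset_Icc h1 h3)
  refine ⟨hi hac hcd hdb, fun x hx => ?_⟩
  rw [hF.eq x ⟨hac.trans hx.1, hx.2.trans hdb⟩, hF.eq c ⟨hac, hcd.trans hdb⟩, add_assoc,
    intervalIntegral.integral_add_adjacent_intervals (hi le_rfl hac (hcd.trans hdb))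
      (hi hac hx.1 (hx.2.trans hdb))]

theorem conjugate (hF : IsPrimitive a b F f) :
    IsPrimitive a b (fun x => conj (F x)) (fun x => conj (f x)) := by
  refine ⟨⟨?_, ?_⟩, fun x hx => ?_⟩
  · exact hF.intervalIntegrable.1.norm.mono'
      (Complex.continuous_conj.comp_aestronglyMeasurable hF.intervalIntegrable.1.1)
      (Filter.Eventually.of_forall fun x => by simp)
  · exact hF.intervalIntegrable.2.norm.mono'
      (Complex.continuous_conj.comp_aestronglyMeasurable hF.intervalIntegrable.2.1)
      (Filter.Eventually.of_forall fun x => by simp)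
  · rw [hF.eq x hx, map_add, intervalIntegral.integral_of_le hx.1,
      intervalIntegral.integral_of_le hx.1, integral_conj]

/-- The product rule, that is, integration by parts. -/
theorem mul (hab : a ≤ b) (hF : IsPrimitive a b F f) (hG : IsPrimitive a b G g) :
    IsPrimitive a b (fun x => F x * G x) (fun x => f x * G x + F x * g x) := by
  have hFc := hF.continuousOn hab
  have hGc := hG.continuousOn hab
  rw [← uIcc_of_le hab] at hFc hGc
  have hi : IntervalIntegrable (fun x => f x * G x + F x * g x) volume a b :=
    (hF.intervalIntegrable.mul_continuousOn hGc).add (hG.intervalIntegrable.continuousOn_mul hFc)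
  refine ⟨hi, ?_⟩
  obtain ⟨F₁, hF1, hF2, hF3⟩ := hF.intervalIntegrable.exists_absolutelyContinuous_primitive hab
  obtain ⟨G₁, hG1, hG2, hG3⟩ := hG.intervalIntegrable.exists_absolutelyContinuous_primitive hab
  obtain ⟨H₁, hH1, hH2, hH3⟩ := hi.exists_absolutelyContinuous_primitive hab
  have hconst : ∀ c : ℂ, AbsolutelyContinuousOnInterval (fun _ : ℝ => c) a b := fun c =>
    (LipschitzWith.const c).lipschitzOnWith.absolutelyContinuousOnInterval
  have hFe : ∀ x ∈ uIcc a b, F x = F a + F₁ x := fun x hx => by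
    rw [uIcc_of_le hab] at hx
    rw [hF2 x hx, ← hF.eq x hx]
  have hGe : ∀ x ∈ uIcc a b, G x = G a + G₁ x := fun x hx => by
    rw [uIcc_of_le hab] at hx
    rw [hG2 x hx, ← hG.eq x hx]
  -- The product minus the integral of its formal derivative is absolutely continuous with
  -- derivative zero almost everywhere, hence constant.
  have hP := (((hconst (F a)).add hF1).smul ((hconst (G a)).add hG1)).sub hH1
  obtain ⟨C, hC⟩ := hP.const_of_ae_hasDerivAt_zero (by
    filter_upwards [hF3, hG3, hH3] with x h1 h2 h3 hx
    have h4 := (((h1 hx).const_add (F a)).mul ((h2 hx).const_add (G a))).sub (h3 hx)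
    rw [hFe x hx, hGe x hx, sub_self] at h4
    exact h4)
  intro x hx
  have hx' : x ∈ uIcc a b := by rwa [uIcc_of_le hab]
  have e1 := hC x hx'
  have e2 := hC a left_mem_uIcc
  have e3 := hH2 a (left_mem_Icc.2 hab)
  simp only [Pi.sub_apply, Pi.mul_apply, Pi.add_apply, smul_eq_mul, ← hFe x hx', ← hGe x hx',
    ← hFe a left_mem_uIcc, ← hGe a left_mem_uIcc, hH2 x hx, e3, intervalIntegral.integral_same,
    sub_zero] at e1 e2
  rw [e2, ← e1]
  ring

theorem of_hasDerivAt (hab : a ≤ b) (hd : ∀ x ∈ Icc a b, HasDerivAt F (f x) x)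
    (hc : ContinuousOn f (Icc a b)) : IsPrimitive a b F f := by
  rw [← uIcc_of_le hab] at hc
  refine ⟨hc.intervalIntegrable, fun x hx => ?_⟩
  have hsub : uIcc a x ⊆ uIcc a b := by
    rw [uIcc_of_le hx.1, uIcc_of_le hab]
    exact Icc_subset_Icc_right hx.2
  rw [intervalIntegral.integral_eq_sub_of_hasDerivAt (f := F)
    (fun y hy => hd y (by rw [← uIcc_of_le hab]; exact hsub hy))
    (hc.mono hsub).intervalIntegrable]
  ring

/-- The derivative of `q |φ|²`, integrated. -/
theorem integral_weight_mul_normSq (hab : a ≤ b) (hF : IsPrimitive a b F f) {q q' : ℝ → ℝ}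
    (hq : ∀ x ∈ Icc a b, HasDerivAt q (q' x) x) (hq' : ContinuousOn q' (Icc a b)) :
    ∫ x in a..b, (q' x * ‖F x‖ ^ 2 + 2 * q x * (conj (F x) * f x).re) =
      q b * ‖F b‖ ^ 2 - q a * ‖F a‖ ^ 2 := by
  have hQ : IsPrimitive a b (fun x => (q x : ℂ)) (fun x => (q' x : ℂ)) :=
    of_hasDerivAt hab (fun x hx => (hq x hx).ofReal_comp)
      (Complex.continuous_ofReal.comp_continuousOn hq')
  have h := (hQ.mul hab hF).mul hab (hF.conjugate)
  have h1 := h.integral_eq hab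
  have h2 := congrArg Complex.re h1
  rw [intervalIntegral.integral_of_le hab] at h2 ⊢
  have h3 := h.intervalIntegrable.1
  rw [show (∫ x in Ioc a b, ((q' x : ℂ) * F x + q x * f x) * conj (F x) +
    q x * F x * conj (f x)).re = _ from (integral_re h3).symm] at h2
  have e : ∀ x : ℝ, (q x : ℂ) * F x * conj (F x) = ((q x * ‖F x‖ ^ 2 : ℝ) : ℂ) := fun x => by
    rw [mul_assoc, Complex.mul_conj, Complex.normSq_eq_norm_sq]
    push_cast
    rfl
  simp only [e] at h2
  rw [Complex.sub_re, Complex.ofReal_re, Complex.ofReal_re] at h2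
  rw [← h2]
  refine integral_congr_ae (Filter.Eventually.of_forall fun x => ?_)
  simp only [RCLike.re_eq_complex_re]
  rw [← Complex.normSq_eq_norm_sq, Complex.normSq_apply]
  simp only [Complex.add_re, Complex.mul_re, Complex.mul_im, Complex.conj_re, Complex.conj_im,
    Complex.ofReal_re, Complex.ofReal_im, Complex.add_im]
  ring

/-- Wirtinger's inequality, with any constant below the sharp one. -/
theorem wirtinger (hab : a < b) (hF : IsPrimitive a b F f)
    (hf2 : IntervalIntegrable (fun x => ‖f x‖ ^ 2) volume a b) (ha : F a = 0) (hb : F b = 0)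
    {c : ℝ} (hc : 0 ≤ c) (hcπ : c * (b - a) < Real.pi) :
    c ^ 2 * ∫ x in a..b, ‖F x‖ ^ 2 ≤ ∫ x in a..b, ‖f x‖ ^ 2 := by
  set m := (a + b) / 2 with hm
  -- A solution of `w'' = -c² w`, centred at the midpoint so that `c (b - a) < π` keeps it positive
  -- on `[a, b]`. Its logarithmic derivative `q` satisfies the Riccati equation `q' = -c² - q²`.
  set w : ℝ → ℝ := fun x => Real.cos (c * (x - m)) with hw
  have hwpos : ∀ x ∈ Icc a b, 0 < w x := by
    intro x hx
    refine Real.cos_pos_of_mem_Ioo ⟨?_, ?_⟩ <;>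
    nlinarith [mul_nonneg hc (sub_nonneg.2 hx.1), mul_nonneg hc (sub_nonneg.2 hx.2)]
  set q : ℝ → ℝ := fun x => -c * Real.sin (c * (x - m)) / w x with hq
  set q' : ℝ → ℝ := fun x => -c ^ 2 - q x ^ 2 with hq'
  have hwd : ∀ x, HasDerivAt w (-c * Real.sin (c * (x - m))) x := by
    intro x
    exact (((hasDerivAt_id' x).sub_const m).const_mul c).cos.congr_deriv (by ring)
  have hqd : ∀ x ∈ Icc a b, HasDerivAt q (q' x) x := by
    intro x hx
    have h1 := (((hasDerivAt_id' x).sub_const m).const_mul c).sin.const_mul (-c)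
    have h2 := h1.div (hwd x) (hwpos x hx).ne'
    have hne := (hwpos x hx).ne'
    refine HasDerivAt.congr_deriv (f := q) h2 ?_
    change _ = -c ^ 2 - (-c * Real.sin (c * (x - m)) / w x) ^ 2
    rw [div_pow, eq_sub_iff_add_eq, ← add_div, div_eq_iff (pow_ne_zero 2 hne)]
    simp only [w]
    ring
  have hqc : ContinuousOn q (Icc a b) := fun x hx => (hqd x hx).continuousAt.continuousWithinAt
  have hq'c : ContinuousOn q' (Icc a b) := continuousOn_const.sub (hqc.pow 2)
  have hFc := hF.continuousOn hab.le
  have key := hF.integral_weight_mul_normSq hab.le hqd hq'c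
  rw [ha, hb] at key
  simp only [norm_zero, ne_eq, OfNat.ofNat_ne_zero, not_false_eq_true, zero_pow, mul_zero,
    sub_zero] at key
  have hu := uIcc_of_le hab.le
  have i1 : IntervalIntegrable (fun x => ‖F x‖ ^ 2) volume a b := by
    refine ContinuousOn.intervalIntegrable ?_
    rw [hu]
    exact hFc.norm.pow 2
  have i2 : IntervalIntegrable (fun x => (conj (F x) * f x)) volume a b := by
    refine hF.intervalIntegrable.continuousOn_mul ?_
    rw [hu]
    exact Complex.continuous_conj.comp_continuousOn hFc
  have i3 : IntervalIntegrable (fun x => (conj (F x) * f x).re) volume a b := ⟨i2.1.re, i2.2.re⟩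
  have i4 : IntervalIntegrable
      (fun x => q' x * ‖F x‖ ^ 2 + 2 * q x * (conj (F x) * f x).re) volume a b := by
    refine IntervalIntegrable.add ?_ ?_
    · exact i1.continuousOn_mul (by rwa [hu])
    · exact i3.continuousOn_mul (by rw [hu]; exact continuousOn_const.mul hqc)
  -- By the Riccati equation the integrand is `|f - q F|²`; the subtracted term is the derivative of
  -- `q |F|²` and integrates to zero because `F` vanishes at both ends.
  have h0 : 0 ≤ ∫ x in a..b, ((‖f x‖ ^ 2 - c ^ 2 * ‖F x‖ ^ 2) -
      (q' x * ‖F x‖ ^ 2 + 2 * q x * (conj (F x) * f x).re)) := by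
    refine intervalIntegral.integral_nonneg hab.le fun x _ => ?_
    have : 0 ≤ ‖f x - q x * F x‖ ^ 2 := sq_nonneg _
    refine this.trans_eq ?_
    simp only [q', ← Complex.normSq_eq_norm_sq, Complex.normSq_apply, Complex.sub_re,
      Complex.sub_im, Complex.mul_re, Complex.mul_im, Complex.conj_re, Complex.conj_im,
      Complex.ofReal_re, Complex.ofReal_im]
    ring
  rw [intervalIntegral.integral_sub (hf2.sub (i1.const_mul _)) i4, key, sub_zero,
    intervalIntegral.integral_sub hf2 (i1.const_mul _), intervalIntegral.integral_const_mul] at h0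
  linarith

/-- The boundary values of a function are controlled by the `L²` norms of it and its derivative. -/
theorem trace_aux (hab : a ≤ b) (hF : IsPrimitive a b F f)
    (hf2 : IntervalIntegrable (fun x => ‖f x‖ ^ 2) volume a b) {q : ℝ → ℝ} {r ε : ℝ} (hε : 0 < ε)
    (hq : ∀ x, HasDerivAt q r x) (hq1 : ∀ x ∈ Icc a b, |q x| ≤ 1) :
    |q b * ‖F b‖ ^ 2 - q a * ‖F a‖ ^ 2| ≤
      (|r| + ε⁻¹) * (∫ x in a..b, ‖F x‖ ^ 2) + ε * ∫ x in a..b, ‖f x‖ ^ 2 := by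
  have hFc := hF.continuousOn hab
  have i1 : IntervalIntegrable (fun x => ‖F x‖ ^ 2) volume a b := by
    refine ContinuousOn.intervalIntegrable ?_
    rw [uIcc_of_le hab]
    exact hFc.norm.pow 2
  rw [← hF.integral_weight_mul_normSq hab (fun x _ => hq x) continuousOn_const,
    ← intervalIntegral.integral_const_mul, ← intervalIntegral.integral_const_mul,
    ← intervalIntegral.integral_add (i1.const_mul _) (hf2.const_mul _), ← Real.norm_eq_abs]
  refine intervalIntegral.norm_integral_le_of_norm_le hab ?_ ((i1.const_mul _).add (hf2.const_mul _))
  refine Filter.Eventually.of_forall fun x hx => ?_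
  have h1 : |(conj (F x) * f x).re| ≤ ‖F x‖ * ‖f x‖ := by
    refine (Complex.abs_re_le_norm _).trans ?_
    rw [norm_mul, Complex.norm_conj]
  have h2 : 2 * (‖F x‖ * ‖f x‖) ≤ ε⁻¹ * ‖F x‖ ^ 2 + ε * ‖f x‖ ^ 2 := by
    have h3 : 0 ≤ ε⁻¹ * (‖F x‖ - ε * ‖f x‖) ^ 2 := by positivity
    have h4 : ε⁻¹ * (‖F x‖ - ε * ‖f x‖) ^ 2 =
        ε⁻¹ * ‖F x‖ ^ 2 - 2 * (ε⁻¹ * ε) * (‖F x‖ * ‖f x‖) + (ε⁻¹ * ε) * ε * ‖f x‖ ^ 2 := by ring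
    rw [inv_mul_cancel₀ hε.ne'] at h4
    linarith
  rw [Real.norm_eq_abs]
  calc |r * ‖F x‖ ^ 2 + 2 * q x * (conj (F x) * f x).re|
      ≤ |r| * ‖F x‖ ^ 2 + 2 * |q x| * |(conj (F x) * f x).re| := by
        refine (abs_add_le _ _).trans ?_
        simp [abs_mul]
    _ ≤ |r| * ‖F x‖ ^ 2 + 2 * 1 * (‖F x‖ * ‖f x‖) := by
        gcongr
        exact hq1 x (Ioc_subset_Icc_self hx)
    _ ≤ _ := by linarith

/-- The affine weight going from `-1` at `a` to `0` at `b` isolates the left boundary term in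
`trace_aux`. The right end is treated by the mirrored weight. -/
theorem norm_sq_left_le (hab : a < b) (hF : IsPrimitive a b F f)
    (hf2 : IntervalIntegrable (fun x => ‖f x‖ ^ 2) volume a b) {ε : ℝ} (hε : 0 < ε) :
    ‖F a‖ ^ 2 ≤ ((b - a)⁻¹ + ε⁻¹) * (∫ x in a..b, ‖F x‖ ^ 2) + ε * ∫ x in a..b, ‖f x‖ ^ 2 := by
  have hpos : 0 < b - a := sub_pos.2 hab
  have h := hF.trace_aux hab.le hf2 (q := fun x => (x - b) * (b - a)⁻¹) (r := (b - a)⁻¹) hε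
    (fun x => by simpa using ((hasDerivAt_id x).sub_const b).mul_const (b - a)⁻¹)
    (fun x hx => by
      rw [abs_mul, abs_of_pos (inv_pos.2 hpos), abs_of_nonpos (sub_nonpos.2 hx.2),
        ← div_eq_mul_inv, div_le_one hpos]
      linarith [hx.1])
  rw [abs_of_pos (inv_pos.2 hpos)] at h
  refine le_trans (le_of_eq ?_) ((le_abs_self _).trans h)
  rw [sub_self, zero_mul, zero_mul, ← neg_sub b a, neg_mul, mul_inv_cancel₀ hpos.ne']
  ring

theorem norm_sq_right_le (hab : a < b) (hF : IsPrimitive a b F f)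
    (hf2 : IntervalIntegrable (fun x => ‖f x‖ ^ 2) volume a b) {ε : ℝ} (hε : 0 < ε) :
    ‖F b‖ ^ 2 ≤ ((b - a)⁻¹ + ε⁻¹) * (∫ x in a..b, ‖F x‖ ^ 2) + ε * ∫ x in a..b, ‖f x‖ ^ 2 := by
  have hpos : 0 < b - a := sub_pos.2 hab
  have h := hF.trace_aux hab.le hf2 (q := fun x => (x - a) * (b - a)⁻¹) (r := (b - a)⁻¹) hε
    (fun x => by simpa using ((hasDerivAt_id x).sub_const a).mul_const (b - a)⁻¹)
    (fun x hx => by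
      rw [abs_mul, abs_of_pos (inv_pos.2 hpos), abs_of_nonneg (sub_nonneg.2 hx.1),
        ← div_eq_mul_inv, div_le_one hpos]
      linarith [hx.2])
  rw [abs_of_pos (inv_pos.2 hpos)] at h
  refine le_trans (le_of_eq ?_) ((le_abs_self _).trans h)
  rw [sub_self, zero_mul, zero_mul, mul_inv_cancel₀ hpos.ne']
  ring

end IsPrimitive

end Primitive

/-! ### Weak derivatives are the same as primitives -/

section WeakDerivative

theorem IsPrimitive.hasWeakDeriv {l : ℝ} (hl : 0 ≤ l) {f g : ℝ → ℂ} (h : IsPrimitive 0 l f g) :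
    HasWeakDeriv l f g := by
  have hfc := h.continuousOn hl
  refine ⟨(hfc.integrableOn_compact isCompact_Icc).mono_set Ioo_subset_Icc_self,
    h.intervalIntegrable.1.mono_set Ioo_subset_Ioc_self, fun η h1 h2 h3 => ?_⟩
  have hd : Continuous (deriv η) := h1.continuous_deriv (by simp)
  have hQ : IsPrimitive 0 l (fun x => ((η x : ℝ) : ℂ)) (fun x => ((deriv η x : ℝ) : ℂ)) :=
    IsPrimitive.of_hasDerivAt hl
      (fun x _ => ((h1.differentiable (by simp)).differentiableAt.hasDerivAt).ofReal_comp)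
      (Complex.continuous_ofReal.comp hd).continuousOn
  have h4 := (hQ.mul hl h).integral_eq hl
  have h0 : η 0 = 0 := image_eq_zero_of_notMem_tsupport fun hx => lt_irrefl _ (h3 hx).1
  have h5 : η l = 0 := image_eq_zero_of_notMem_tsupport fun hx => lt_irrefl _ (h3 hx).2
  rw [h0, h5, intervalIntegral.integral_of_le hl, integral_Ioc_eq_integral_Ioo] at h4
  simp only [Complex.ofReal_zero, zero_mul, sub_zero] at h4
  rw [integral_add] at h4
  · simp only [Complex.real_smul]
    exact eq_neg_of_add_eq_zero_left h4
  · exact HasWeakDeriv.integrable_smul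
      ((hfc.integrableOn_compact isCompact_Icc).mono_set Ioo_subset_Icc_self) hd h2.deriv
  · exact HasWeakDeriv.integrable_smul
      (h.intervalIntegrable.1.mono_set Ioo_subset_Ioc_self) h1.continuous h2

/-- A test function of mean zero is the derivative of a test function. -/
theorem exists_testFunction_deriv_eq {l : ℝ} {θ : ℝ → ℝ} (h1 : ContDiff ℝ (⊤ : ℕ∞) θ)
    (h2 : HasCompactSupport θ) (h3 : tsupport θ ⊆ Ioo 0 l) (h0 : ∫ x in Ioo 0 l, θ x = 0) :
    ∃ η : ℝ → ℝ, ContDiff ℝ (⊤ : ℕ∞) η ∧ HasCompactSupport η ∧ tsupport η ⊆ Ioo 0 l ∧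
      deriv η = θ := by
  rcases (tsupport θ).eq_empty_or_nonempty with he | hne
  · refine ⟨0, contDiff_const, HasCompactSupport.zero, by simp, ?_⟩
    rw [tsupport_eq_empty_iff] at he
    rw [he]
    exact deriv_const' 0
  obtain ⟨a, ha, ha'⟩ := h2.isCompact.exists_isLeast hne
  obtain ⟨b, hb, hb'⟩ := h2.isCompact.exists_isGreatest hne
  have hz : ∀ x, x ∉ Icc a b → θ x = 0 := fun x hx =>
    image_eq_zero_of_notMem_tsupport fun h => hx ⟨ha' h, hb' h⟩
  have hab : a ≤ b := ha' hb
  have hθi : ∀ x y, IntervalIntegrable θ volume x y := fun x y => h1.continuous.intervalIntegrable x y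
  have hlz : ∀ x ≤ a, ∫ t in a..x, θ t = 0 := by
    intro x hx
    rw [intervalIntegral.integral_symm, intervalIntegral.integral_of_le hx,
      integral_Ioc_eq_integral_Ioo, setIntegral_eq_zero_of_forall_eq_zero, neg_zero]
    exact fun t ht => hz t fun h => not_le.2 ht.2 h.1
  have hrz : ∀ x, b ≤ x → ∫ t in b..x, θ t = 0 := by
    intro x hx
    rw [intervalIntegral.integral_of_le hx, setIntegral_eq_zero_of_forall_eq_zero]
    exact fun t ht => hz t fun h => not_le.2 ht.1 h.2
  have hl : 0 < l := (h3 ha).1.trans (h3 ha).2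
  have hab0 : ∫ t in a..b, θ t = 0 := by
    have e1 : ∫ t in (0 : ℝ)..l, θ t = 0 := by
      rwa [intervalIntegral.integral_of_le hl.le, integral_Ioc_eq_integral_Ioo]
    rw [← intervalIntegral.integral_add_adjacent_intervals (hθi 0 a) (hθi a l),
      ← intervalIntegral.integral_add_adjacent_intervals (hθi a b) (hθi b l),
      intervalIntegral.integral_symm, hlz 0 (h3 ha).1.le, hrz l (h3 hb).2.le] at e1
    simpa using e1
  have hd : ∀ x, HasDerivAt (fun x => ∫ t in a..x, θ t) (θ x) x := fun x =>
    intervalIntegral.integral_hasDerivAt_right (hθi _ _)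
      (h1.continuous.stronglyMeasurableAtFilter _ _) h1.continuous.continuousAt
  have hderiv : deriv (fun x => ∫ t in a..x, θ t) = θ := funext fun x => (hd x).deriv
  -- The primitive is `0` to the left of the support of `θ`, and to the right it equals the total
  -- integral, which is again `0`.
  have hsupp : Function.support (fun x => ∫ t in a..x, θ t) ⊆ Icc a b := by
    intro x hx
    by_contra hx'
    refine hx ?_
    rcases le_or_gt x a with h | h
    · exact hlz x h
    · have hbx : b ≤ x := by
        by_contra! h'
        exact hx' ⟨h.le, h'.le⟩
      change ∫ t in a..x, θ t = 0
      rw [← intervalIntegral.integral_add_adjacent_intervals (hθi a b) (hθi b x), hab0, hrz x hbx,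
        add_zero]
  have hts : tsupport (fun x => ∫ t in a..x, θ t) ⊆ Icc a b := closure_minimal hsupp isClosed_Icc
  refine ⟨_, ?_, HasCompactSupport.of_support_subset_isCompact isCompact_Icc hsupp,
    hts.trans (Icc_subset_Ioo (h3 ha).1 (h3 hb).2), hderiv⟩
  rw [contDiff_infty_iff_deriv]
  exact ⟨fun x => (hd x).differentiableAt, by rwa [hderiv]⟩

/-- The du Bois-Reymond lemma: any test function becomes a derivative of a test function after
subtracting a multiple of a fixed bump, so `f` integrates against it like the constant `C`. -/
theorem HasWeakDeriv.eq_const {l : ℝ} (hl : 0 < l) {f : ℝ → ℂ} (h : HasWeakDeriv l f 0)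
    (hc : ContinuousOn f (Icc 0 l)) : ∀ x ∈ Icc 0 l, f x = f 0 := by
  obtain ⟨χ₀, hχ₀s, hχ₀c, hχ₀d, hχ₀p, hχ₀1⟩ := exists_contDiff_tsupport_subset (n := (⊤ : ℕ∞))
    (Ioo_mem_nhds (half_pos hl) (half_lt_self hl))
  have hχ₀int : 0 < ∫ x in Ioo 0 l, χ₀ x := by
    rw [setIntegral_eq_integral_of_forall_compl_eq_zero fun x hx =>
      image_eq_zero_of_notMem_tsupport fun h => hx (hχ₀s h)]
    refine hχ₀d.continuous.integral_pos_of_hasCompactSupport_nonneg_nonzero hχ₀c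
      (fun x => (hχ₀p ⟨x, rfl⟩).1) (x := l / 2) ?_
    rw [hχ₀1]
    exact one_ne_zero
  set I := ∫ x in Ioo 0 l, χ₀ x with hI
  set C : ℂ := I⁻¹ • ∫ x in Ioo 0 l, χ₀ x • f x with hC
  have key : ∀ᵐ x ∂volume, x ∈ Ioo 0 l → f x - C = 0 := by
    refine isOpen_Ioo.ae_eq_zero_of_integral_contDiff_smul_eq_zero
      (h.1.sub (integrableOn_const (by simp))).locallyIntegrableOn ?_
    intro ψ p1 p2 p3
    set m := ∫ x in Ioo 0 l, ψ x with hm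
    have hψi : IntegrableOn ψ (Ioo 0 l) := (p1.continuous.integrable_of_hasCompactSupport p2).integrableOn
    have hχi : IntegrableOn χ₀ (Ioo 0 l) :=
      (hχ₀d.continuous.integrable_of_hasCompactSupport hχ₀c).integrableOn
    set θ : ℝ → ℝ := fun x => ψ x - (m * I⁻¹) * χ₀ x with hθ
    have hsupp : Function.support θ ⊆ tsupport ψ ∪ tsupport χ₀ := by
      intro x hx
      by_contra hx'
      rw [mem_union, not_or] at hx'
      refine hx ?_
      simp only [hθ]
      rw [image_eq_zero_of_notMem_tsupport hx'.1, image_eq_zero_of_notMem_tsupport hx'.2]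
      simp
    have hcl : IsCompact (tsupport ψ ∪ tsupport χ₀) := p2.isCompact.union hχ₀c.isCompact
    obtain ⟨η, e1, e2, e3, e4⟩ := exists_testFunction_deriv_eq (l := l) (θ := θ)
      (p1.sub (contDiff_const.mul hχ₀d)) (HasCompactSupport.of_support_subset_isCompact hcl hsupp)
      ((closure_minimal hsupp hcl.isClosed).trans (union_subset p3 hχ₀s)) (by
        simp only [hθ]
        rw [integral_sub hψi (hχi.const_mul _), integral_const_mul, ← hm, ← hI, mul_assoc,
          inv_mul_cancel₀ hχ₀int.ne', mul_one, sub_self])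
    have e5 := h.2.2 η e1 e2 e3
    rw [e4] at e5
    simp only [Pi.zero_apply, smul_zero, integral_zero, neg_zero] at e5
    have i1 := HasWeakDeriv.integrable_smul h.1 p1.continuous p2
    have i2 := HasWeakDeriv.integrable_smul h.1 hχ₀d.continuous hχ₀c
    have e6 : ∫ x in Ioo 0 l, θ x • f x =
        (∫ x in Ioo 0 l, ψ x • f x) - (m * I⁻¹) • ∫ x in Ioo 0 l, χ₀ x • f x := by
      have i3 : IntegrableOn (fun x => (m * I⁻¹) • χ₀ x • f x) (Ioo 0 l) := i2.smul (m * I⁻¹)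
      rw [← integral_smul, ← integral_sub i1 i3]
      refine integral_congr_ae (Filter.Eventually.of_forall fun x => ?_)
      simp only [hθ, sub_smul, mul_smul]
    rw [← setIntegral_eq_integral_of_forall_compl_eq_zero (s := Ioo 0 l) fun x hx => by
      rw [image_eq_zero_of_notMem_tsupport fun h => hx (p3 h), zero_smul]]
    simp only [smul_sub]
    rw [integral_sub i1 (hψi.smul_const C), integral_smul_const, ← hm, hC, smul_smul, ← e6, e5]
  have h2 : f =ᵐ[volume.restrict (Icc 0 l)] fun _ => C := by
    rw [← restrict_Ioo_eq_restrict_Icc]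
    refine (ae_restrict_iff' measurableSet_Ioo).2 ?_
    filter_upwards [key] with x hx hx'
    exact sub_eq_zero.1 (hx hx')
  have h3 := Measure.eqOn_Icc_of_ae_eq volume hl.ne h2 hc continuousOn_const
  intro x hx
  rw [h3 hx, h3 (left_mem_Icc.2 hl.le)]

/-- Subtracting the integral of `g` from `f` leaves a continuous function with weak derivative zero.
-/
theorem HasWeakDeriv.isPrimitive {l : ℝ} (hl : 0 < l) {f g : ℝ → ℂ} (h : HasWeakDeriv l f g)
    (hc : ContinuousOn f (Icc 0 l)) : IsPrimitive 0 l f g := by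
  have hgi : IntervalIntegrable g volume 0 l := by
    rw [intervalIntegrable_iff_integrableOn_Ioo_of_le hl.le]
    exact h.2.1
  have hW : IsPrimitive 0 l (fun x => ∫ t in (0 : ℝ)..x, g t) g := ⟨hgi, fun x _ => by simp⟩
  have h1 := h.add ((hW.hasWeakDeriv hl.le).smul (-1))
  have h2 := (h1.congr (g₁ := 0) (by simp)).eq_const hl
    (hc.add ((hW.continuousOn hl.le).const_smul (-1 : ℂ)))
  refine ⟨hgi, fun x hx => ?_⟩
  have h3 := h2 x hx
  simp only [Pi.add_apply, Pi.smul_apply, intervalIntegral.integral_same, smul_eq_mul] at h3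
  linear_combination h3

/-- Wirtinger's inequality for a function that vanishes at `n + 2` equidistant points. -/
theorem IsPrimitive.wirtinger_subdivision {l : ℝ} (hl : 0 < l) {F f : ℝ → ℂ}
    (hF : IsPrimitive 0 l F f) (hf2 : IntervalIntegrable (fun x => ‖f x‖ ^ 2) volume 0 l) (n : ℕ)
    (h0 : ∀ j ≤ n + 1, F (l * j / (n + 1)) = 0) {c : ℝ} (hc : 0 ≤ c)
    (hcπ : c * l < Real.pi * (n + 1)) :
    c ^ 2 * ∫ x in (0 : ℝ)..l, ‖F x‖ ^ 2 ≤ ∫ x in (0 : ℝ)..l, ‖f x‖ ^ 2 := by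
  set a : ℕ → ℝ := fun j => l * j / (n + 1) with ha
  have hn : (0 : ℝ) < n + 1 := by positivity
  have ha0 : a 0 = 0 := by simp [ha]
  have han : a (n + 1) = l := by
    simp only [ha]
    push_cast
    field_simp
  have hstep : ∀ j, a (j + 1) - a j = l / (n + 1) := fun j => by
    simp only [ha]
    push_cast
    ring
  have hlt : ∀ j, a j < a (j + 1) := fun j => by
    have := hstep j
    have h1 : 0 < l / (n + 1) := by positivity
    linarith
  have hmono : Monotone a := monotone_nat_of_le_succ fun j => (hlt j).le
  have h0' : ∀ j, 0 ≤ a j := fun j => ha0 ▸ hmono (Nat.zero_le j)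
  have hl' : ∀ j ≤ n + 1, a j ≤ l := fun j hj => han ▸ hmono hj
  have hsub : ∀ j < n + 1, uIcc (a j) (a (j + 1)) ⊆ uIcc 0 l := fun j hj => by
    rw [uIcc_of_le (hlt j).le, uIcc_of_le hl.le]
    exact Icc_subset_Icc (h0' j) (hl' _ hj)
  have i1 : IntervalIntegrable (fun x => ‖F x‖ ^ 2) volume 0 l := by
    refine ContinuousOn.intervalIntegrable ?_
    rw [uIcc_of_le hl.le]
    exact (hF.continuousOn hl.le).norm.pow 2
  have e1 := intervalIntegral.sum_integral_adjacent_intervals (a := a) (n := n + 1)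
    (fun j hj => i1.mono_set (hsub j hj))
  have e2 := intervalIntegral.sum_integral_adjacent_intervals (a := a) (n := n + 1)
    (fun j hj => hf2.mono_set (hsub j hj))
  rw [ha0, han] at e1 e2
  rw [← e1, ← e2, Finset.mul_sum]
  refine Finset.sum_le_sum fun j hj => ?_
  have hj' := Finset.mem_range.1 hj
  -- Each of the `n + 1` pieces has length `l / (n + 1)`, so `hcπ` is the condition of `wirtinger`
  -- on a piece.
  refine (hF.mono (h0' j) (hlt j).le (hl' _ hj')).wirtinger (hlt j) (hf2.mono_set (hsub j hj'))
    (h0 j hj'.le) (h0 (j + 1) hj') hc ?_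
  rw [hstep, ← mul_div_assoc, div_lt_iff₀ hn]
  exact hcπ

end WeakDerivative

/-! ### The Hilbert space of one edge and integration on it -/

section EdgeSpace

/-- The functions of class `L²` on the edge of length `l`. -/
abbrev EdgeL2 (l : ℝ) : Type := Lp ℂ 2 (volume.restrict (Ioo (0 : ℝ) l))

variable {l : ℝ}

theorem EdgeL2.intervalIntegrable (hl : 0 ≤ l) (g : EdgeL2 l) :
    IntervalIntegrable g volume 0 l := by
  rw [intervalIntegrable_iff_integrableOn_Ioo_of_le hl]
  exact (Lp.memLp g).integrable (by norm_num)

theorem EdgeL2.intervalIntegrable_norm_sq (hl : 0 ≤ l) (g : EdgeL2 l) :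
    IntervalIntegrable (fun x => ‖g x‖ ^ 2) volume 0 l := by
  rw [intervalIntegrable_iff_integrableOn_Ioo_of_le hl]
  exact (Lp.memLp g).integrable_norm_pow (by norm_num)

theorem EdgeL2.inner_eq (hl : 0 ≤ l) (f g : EdgeL2 l) :
    inner ℂ f g = ∫ x in (0 : ℝ)..l, (starRingEnd ℂ) (f x) * g x := by
  rw [L2.inner_def, intervalIntegral.integral_of_le hl, integral_Ioc_eq_integral_Ioo]
  refine integral_congr_ae (Filter.Eventually.of_forall fun x => ?_)
  simp [mul_comm]

theorem EdgeL2.norm_sq_eq (hl : 0 ≤ l) (g : EdgeL2 l) :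
    ‖g‖ ^ 2 = ∫ x in (0 : ℝ)..l, ‖g x‖ ^ 2 := by
  have h := EdgeL2.inner_eq hl g g
  rw [inner_self_eq_norm_sq_to_K] at h
  have h2 : ∀ x, (starRingEnd ℂ) (g x) * g x = ((‖g x‖ ^ 2 : ℝ) : ℂ) := fun x => by
    rw [Complex.conj_mul']
    push_cast
    rfl
  simp only [h2] at h
  rw [intervalIntegral.integral_ofReal] at h
  exact Complex.ofReal_injective ((Complex.ofReal_pow _ _).trans h)

/-- The indicator function of `(0, x)`. -/
def EdgeL2.indicator (l x : ℝ) : EdgeL2 l :=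
  indicatorConstLp 2 (measurableSet_Ioc (a := 0) (b := x)) (by
    exact ((measure_mono (Set.subset_univ _)).trans_lt (measure_lt_top _ _)).ne) 1

/-- Writing the integral as an inner product gives linearity in `g` and, by Cauchy–Schwarz, the
bounds on primitives used below. -/
theorem EdgeL2.inner_indicator {x : ℝ} (hx : x ∈ Icc 0 l) (g : EdgeL2 l) :
    inner ℂ (EdgeL2.indicator l x) g = ∫ t in (0 : ℝ)..x, g t := by
  rw [EdgeL2.indicator, L2.inner_indicatorConstLp_one, intervalIntegral.integral_of_le hx.1,
    Measure.restrict_restrict measurableSet_Ioc]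
  refine setIntegral_congr_set ?_
  have h1 : (Ioc 0 x ∩ Ioo 0 l : Set ℝ) =ᵐ[volume] (Ioc 0 x ∩ Ioc 0 l : Set ℝ) :=
    (Filter.EventuallyEq.refl _ _).inter Ioo_ae_eq_Ioc
  rwa [inter_eq_left.2 (Ioc_subset_Ioc_right hx.2)] at h1

theorem EdgeL2.indicator_ae_eq (l : ℝ) :
    EdgeL2.indicator l l =ᵐ[volume.restrict (Ioo 0 l)] fun _ => 1 := by
  filter_upwards [indicatorConstLp_coeFn (p := 2) (μ := volume.restrict (Ioo 0 l))
      (hs := measurableSet_Ioc (a := 0) (b := l)) (hμs := by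
        exact ((measure_mono (Set.subset_univ _)).trans_lt (measure_lt_top _ _)).ne) (c := (1 : ℂ)),
    ae_restrict_mem measurableSet_Ioo] with x h4 h5
  exact h4.trans (indicator_of_mem (Ioo_subset_Ioc_self h5) _)

theorem EdgeL2.norm_indicator_le (hl : 0 ≤ l) (x : ℝ) : ‖EdgeL2.indicator l x‖ ≤ √l := by
  rw [EdgeL2.indicator, norm_indicatorConstLp (by norm_num) (by norm_num), norm_one, one_mul,
    ENNReal.toReal_ofNat, ← Real.sqrt_eq_rpow]
  refine Real.sqrt_le_sqrt ?_
  refine (measureReal_mono (Set.subset_univ _)).trans ?_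
  simp [measureReal_def, hl]

theorem EdgeL2.norm_integral_le (g : EdgeL2 l) {x : ℝ} (hx : x ∈ Icc 0 l) :
    ‖∫ t in (0 : ℝ)..x, g t‖ ≤ √l * ‖g‖ := by
  rw [← EdgeL2.inner_indicator hx]
  refine (norm_inner_le_norm _ _).trans ?_
  gcongr
  exact EdgeL2.norm_indicator_le (hx.1.trans hx.2) x

theorem EdgeL2.memLp_of_continuousOn {φ : ℝ → ℂ} (h : ContinuousOn φ (Icc 0 l)) :
    MemLp φ 2 (volume.restrict (Ioo 0 l)) := by
  obtain ⟨C, hC⟩ := isCompact_Icc.exists_bound_of_continuousOn h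
  refine MemLp.of_bound ((h.mono Ioo_subset_Icc_self).aestronglyMeasurable measurableSet_Ioo) C ?_
  exact (ae_restrict_iff' measurableSet_Ioo).2
    (Filter.Eventually.of_forall fun x hx => hC x (Ioo_subset_Icc_self hx))

theorem EdgeL2.continuousOn_integral (hl : 0 ≤ l) (g : EdgeL2 l) :
    ContinuousOn (fun x => ∫ t in (0 : ℝ)..x, g t) (Icc 0 l) := by
  have h := intervalIntegral.continuousOn_primitive_interval' (EdgeL2.intervalIntegrable hl g)
    left_mem_uIcc
  rwa [uIcc_of_le hl] at h

theorem EdgeL2.integral_congr (f : EdgeL2 l) {φ : ℝ → ℂ}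
    (h : f =ᵐ[volume.restrict (Ioo 0 l)] φ) {x : ℝ} (hx : x ∈ Icc 0 l) :
    ∫ t in (0 : ℝ)..x, f t = ∫ t in (0 : ℝ)..x, φ t := by
  rw [intervalIntegral.integral_of_le hx.1, intervalIntegral.integral_of_le hx.1,
    integral_Ioc_eq_integral_Ioo, integral_Ioc_eq_integral_Ioo]
  exact integral_congr_ae (ae_restrict_of_ae_restrict_of_subset (Ioo_subset_Ioo_right hx.2) h)

/-- The operator of integration from the left end of the edge. -/
def EdgeL2.volterra (hl : 0 ≤ l) : EdgeL2 l →L[ℂ] EdgeL2 l :=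
  LinearMap.mkContinuousOfExistsBound
    { toFun := fun g => (EdgeL2.memLp_of_continuousOn (EdgeL2.continuousOn_integral hl g)).toLp _
      map_add' := fun f g => by
        rw [← MemLp.toLp_add]
        refine MemLp.toLp_congr _ _ ((ae_restrict_iff' measurableSet_Ioo).2
          (Filter.Eventually.of_forall fun x hx => ?_))
        have hx' := Ioo_subset_Icc_self hx
        simp only [Pi.add_apply, ← EdgeL2.inner_indicator hx', inner_add_right]
      map_smul' := fun c g => by
        rw [RingHom.id_apply, ← MemLp.toLp_const_smul]
        refine MemLp.toLp_congr _ _ ((ae_restrict_iff' measurableSet_Ioo).2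
          (Filter.Eventually.of_forall fun x hx => ?_))
        have hx' := Ioo_subset_Icc_self hx
        simp only [Pi.smul_apply, ← EdgeL2.inner_indicator hx', inner_smul_right, smul_eq_mul] }
    ⟨(measureUnivNNReal (volume.restrict (Ioo 0 l)) : ℝ) ^ (2 : ENNReal).toReal⁻¹ * √l, fun g => by
      rw [mul_assoc]
      refine Lp.norm_le_of_ae_bound (by positivity) ?_
      filter_upwards [MemLp.coeFn_toLp
        (EdgeL2.memLp_of_continuousOn (EdgeL2.continuousOn_integral hl g)),
        ae_restrict_mem measurableSet_Ioo] with x hx hx'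
      rw [LinearMap.coe_mk, AddHom.coe_mk, hx]
      exact EdgeL2.norm_integral_le g (Ioo_subset_Icc_self hx')⟩

theorem EdgeL2.volterra_ae_eq (hl : 0 ≤ l) (g : EdgeL2 l) :
    EdgeL2.volterra hl g =ᵐ[volume.restrict (Ioo 0 l)] fun x => ∫ t in (0 : ℝ)..x, g t :=
  MemLp.coeFn_toLp (EdgeL2.memLp_of_continuousOn (EdgeL2.continuousOn_integral hl g))

end EdgeSpace

/-! ### The form domain, the embedding and the coercive form on a graph -/

namespace MetricGraph

open scoped InnerProductSpace ComplexConjugate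
open ContinuousLinearMap

set_option linter.unusedSectionVars false

variable {V E : Type*} [Fintype V] [Fintype E] (Γ : MetricGraph V E)

/-- A pair `(c, g)` of vertex values and a derivative comes from a continuous function on the
graph when the integral of `g` over each edge is the increment of `c` along that edge. -/
def compatibility : WithLp 2 (EuclideanSpace ℂ V × Γ.L2) →L[ℂ] (E → ℂ) :=
  ContinuousLinearMap.pi fun e =>
    (innerSL ℂ (EdgeL2.indicator (Γ.length e) (Γ.length e))) ∘L PiLp.proj 2 _ e ∘L
        WithLp.sndL 2 ℂ _ _ -
      (EuclideanSpace.proj (Γ.vertex e true) - EuclideanSpace.proj (Γ.vertex e false)) ∘L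
        WithLp.fstL 2 ℂ _ _

/-- The form domain: the functions on `Γ` that are in `H¹` of each edge and continuous at the
vertices, described by their vertex values and their derivative. -/
def FormDomain : Type _ := LinearMap.ker Γ.compatibility.toLinearMap

instance : NormedAddCommGroup Γ.FormDomain :=
  inferInstanceAs (NormedAddCommGroup (LinearMap.ker Γ.compatibility.toLinearMap))

instance : InnerProductSpace ℂ Γ.FormDomain :=
  inferInstanceAs (InnerProductSpace ℂ (LinearMap.ker Γ.compatibility.toLinearMap))

instance : CompleteSpace Γ.FormDomain :=
  Γ.compatibility.isClosed_ker.completeSpace_coe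

/-- The pair of the vertex values and the derivative. -/
def pairL : Γ.FormDomain →L[ℂ] WithLp 2 (EuclideanSpace ℂ V × Γ.L2) where
  toFun u := u.1
  map_add' _ _ := rfl
  map_smul' _ _ := rfl
  cont := continuous_subtype_val

theorem compatibility_eq_zero_iff {p : WithLp 2 (EuclideanSpace ℂ V × Γ.L2)} :
    Γ.compatibility p = 0 ↔ ∀ e, ∫ t in (0 : ℝ)..Γ.length e, p.snd e t =
      p.fst (Γ.vertex e true) - p.fst (Γ.vertex e false) := by
  rw [funext_iff]
  refine forall_congr' fun e => ?_
  rw [← EdgeL2.inner_indicator (right_mem_Icc.2 (Γ.length_pos e).le), ← sub_eq_zero (b := _ - _)]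
  rfl

/-- The value at a vertex. -/
def valL (v : V) : Γ.FormDomain →L[ℂ] ℂ :=
  EuclideanSpace.proj v ∘L WithLp.fstL 2 ℂ _ _ ∘L Γ.pairL

/-- The derivative. -/
def derL : Γ.FormDomain →L[ℂ] Γ.L2 :=
  WithLp.sndL 2 ℂ _ _ ∘L Γ.pairL

/-- The function on the edge `e`. -/
def fn (u : Γ.FormDomain) (e : E) (x : ℝ) : ℂ :=
  Γ.valL (Γ.vertex e false) u + ∫ t in (0 : ℝ)..x, Γ.derL u e t

theorem integral_derL (u : Γ.FormDomain) (e : E) :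
    ∫ t in (0 : ℝ)..Γ.length e, Γ.derL u e t =
      Γ.valL (Γ.vertex e true) u - Γ.valL (Γ.vertex e false) u :=
  Γ.compatibility_eq_zero_iff.1 u.2 e

variable {Γ}

theorem isPrimitive_fn (u : Γ.FormDomain) (e : E) :
    IsPrimitive 0 (Γ.length e) (Γ.fn u e) (Γ.derL u e) :=
  ⟨EdgeL2.intervalIntegrable (Γ.length_pos e).le _, fun x _ => by simp [fn]⟩

theorem fn_endpoint (u : Γ.FormDomain) (e : E) (b : Bool) :
    Γ.fn u e (Γ.endpoint e b) = Γ.valL (Γ.vertex e b) u := by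
  cases b
  · simp [fn, endpoint]
  · simp [fn, endpoint, integral_derL]

theorem fn_zero (u : Γ.FormDomain) (e : E) : Γ.fn u e 0 = Γ.valL (Γ.vertex e false) u :=
  fn_endpoint u e false

theorem fn_length (u : Γ.FormDomain) (e : E) :
    Γ.fn u e (Γ.length e) = Γ.valL (Γ.vertex e true) u :=
  fn_endpoint u e true

theorem continuousOn_fn (u : Γ.FormDomain) (e : E) :
    ContinuousOn (Γ.fn u e) (Icc 0 (Γ.length e)) :=
  (isPrimitive_fn u e).continuousOn (Γ.length_pos e).le

/-- The element of the form domain with given vertex values and derivative. -/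
def mkForm (c : V → ℂ) (g : Γ.L2) (h : ∀ e, ∫ t in (0 : ℝ)..Γ.length e, g e t =
      c (Γ.vertex e true) - c (Γ.vertex e false)) : Γ.FormDomain :=
  ⟨WithLp.toLp 2 (WithLp.toLp 2 c, g), Γ.compatibility_eq_zero_iff.2 h⟩

variable (Γ)

/-- The value at the point `x` of the edge `e`. -/
def evalL (e : E) (x : ℝ) : Γ.FormDomain →L[ℂ] ℂ :=
  Γ.valL (Γ.vertex e false) +
    innerSL ℂ (EdgeL2.indicator (Γ.length e) x) ∘L PiLp.proj 2 _ e ∘L Γ.derL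

variable {Γ}

theorem evalL_apply (u : Γ.FormDomain) (e : E) {x : ℝ} (hx : x ∈ Icc 0 (Γ.length e)) :
    Γ.evalL e x u = Γ.fn u e x := by
  rw [fn, ← EdgeL2.inner_indicator hx]
  rfl

variable (Γ)

/-- The inclusion of the form domain into `L²(Γ)`. -/
def embL : Γ.FormDomain →L[ℂ] Γ.L2 :=
  (PiLp.continuousLinearEquiv 2 ℂ fun e : E => EdgeL2 (Γ.length e)).symm.toContinuousLinearMap ∘L
    ContinuousLinearMap.pi fun e =>
      (Γ.valL (Γ.vertex e false)).smulRight (EdgeL2.indicator (Γ.length e) (Γ.length e)) +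
        EdgeL2.volterra (Γ.length_pos e).le ∘L PiLp.proj 2 _ e ∘L Γ.derL

variable {Γ}

theorem embL_ae_eq (u : Γ.FormDomain) (e : E) :
    Γ.embL u e =ᵐ[volume.restrict (Ioo 0 (Γ.length e))] Γ.fn u e := by
  have h : Γ.embL u e = Γ.valL (Γ.vertex e false) u • EdgeL2.indicator (Γ.length e) (Γ.length e) +
      EdgeL2.volterra (Γ.length_pos e).le (Γ.derL u e) := rfl
  rw [h]
  filter_upwards [Lp.coeFn_add (Γ.valL (Γ.vertex e false) u •
      EdgeL2.indicator (Γ.length e) (Γ.length e))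
      (EdgeL2.volterra (Γ.length_pos e).le (Γ.derL u e)),
    Lp.coeFn_smul (Γ.valL (Γ.vertex e false) u) (EdgeL2.indicator (Γ.length e) (Γ.length e)),
    EdgeL2.volterra_ae_eq (Γ.length_pos e).le (Γ.derL u e),
    EdgeL2.indicator_ae_eq (Γ.length e)] with x h1 h2 h3 h4
  rw [h1, Pi.add_apply, h2, h3, Pi.smul_apply, h4, smul_eq_mul, mul_one, fn]

theorem inner_L2_eq (f g : Γ.L2) :
    ⟪f, g⟫_ℂ = ∑ e, ∫ x in (0 : ℝ)..Γ.length e, conj (f e x) * g e x := by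
  rw [PiLp.inner_apply]
  exact Finset.sum_congr rfl fun e _ => EdgeL2.inner_eq (Γ.length_pos e).le _ _

theorem norm_sq_L2_eq (f : Γ.L2) :
    ‖f‖ ^ 2 = ∑ e, ∫ x in (0 : ℝ)..Γ.length e, ‖f e x‖ ^ 2 := by
  rw [PiLp.norm_sq_eq_of_L2]
  exact Finset.sum_congr rfl fun e _ => EdgeL2.norm_sq_eq (Γ.length_pos e).le _

theorem intervalIntegral_congr_ae_edge {F : Type*} [NormedAddCommGroup F] [NormedSpace ℝ F] {l : ℝ}
    (hl : 0 ≤ l) {f g : ℝ → F} (h : f =ᵐ[volume.restrict (Ioo 0 l)] g) :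
    ∫ x in (0 : ℝ)..l, f x = ∫ x in (0 : ℝ)..l, g x := by
  rw [intervalIntegral.integral_of_le hl, intervalIntegral.integral_of_le hl,
    integral_Ioc_eq_integral_Ioo, integral_Ioc_eq_integral_Ioo]
  exact integral_congr_ae h

theorem inner_embL_eq (u w : Γ.FormDomain) :
    ⟪Γ.embL u, Γ.embL w⟫_ℂ = ∑ e, ∫ x in (0 : ℝ)..Γ.length e, conj (Γ.fn u e x) * Γ.fn w e x := by
  rw [inner_L2_eq]
  refine Finset.sum_congr rfl fun e _ => intervalIntegral_congr_ae_edge (Γ.length_pos e).le ?_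
  filter_upwards [embL_ae_eq u e, embL_ae_eq w e] with x h1 h2
  rw [h1, h2]

theorem norm_sq_embL_eq (u : Γ.FormDomain) :
    ‖Γ.embL u‖ ^ 2 = ∑ e, ∫ x in (0 : ℝ)..Γ.length e, ‖Γ.fn u e x‖ ^ 2 := by
  rw [norm_sq_L2_eq]
  refine Finset.sum_congr rfl fun e _ => intervalIntegral_congr_ae_edge (Γ.length_pos e).le ?_
  filter_upwards [embL_ae_eq u e] with x h1
  rw [h1]

theorem norm_sq_eq_formDomain (u : Γ.FormDomain) :
    ‖u‖ ^ 2 = ∑ v, ‖Γ.valL v u‖ ^ 2 + ‖Γ.derL u‖ ^ 2 := by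
  have h1 := WithLp.prod_norm_sq_eq_of_L2 (Γ.pairL u)
  rw [EuclideanSpace.norm_sq_eq] at h1
  exact h1

variable (Γ)

/-- The self-adjoint operator of the quadratic form `∫ |u'|² + ∑ αᵥ |u(v)|²`. -/
def formOp (α : V → ℝ) : Γ.FormDomain →L[ℂ] Γ.FormDomain :=
  adjoint Γ.derL ∘L Γ.derL + ∑ v, (α v : ℂ) • (adjoint (Γ.valL v) ∘L Γ.valL v)

variable {Γ} {α : V → ℝ}

theorem inner_formOp (u w : Γ.FormDomain) :
    ⟪Γ.formOp α u, w⟫_ℂ = ⟪Γ.derL u, Γ.derL w⟫_ℂ +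
      ∑ v, α v * (conj (Γ.valL v u) * Γ.valL v w) := by
  simp only [formOp, add_apply, comp_apply, inner_add_left, adjoint_inner_left, sum_apply,
    smul_apply, sum_inner, inner_smul_left, Complex.conj_ofReal]
  congr 1
  refine Finset.sum_congr rfl fun v _ => ?_
  rw [RCLike.inner_apply, mul_comm (Γ.valL v w)]

theorem isSelfAdjoint_formOp : IsSelfAdjoint (Γ.formOp α) := by
  rw [isSelfAdjoint_iff_isSymmetric]
  intro u w
  rw [← inner_conj_symm u]
  simp only [coe_coe, inner_formOp, map_add, inner_conj_symm, map_sum, map_mul, Complex.conj_conj,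
    Complex.conj_ofReal]
  congr 1
  exact Finset.sum_congr rfl fun v _ => by ring

theorem re_inner_formOp (u : Γ.FormDomain) :
    (⟪Γ.formOp α u, u⟫_ℂ).re = ‖Γ.derL u‖ ^ 2 + ∑ v, α v * ‖Γ.valL v u‖ ^ 2 := by
  have h : ⟪Γ.formOp α u, u⟫_ℂ =
      ((‖Γ.derL u‖ ^ 2 + ∑ v, α v * ‖Γ.valL v u‖ ^ 2 : ℝ) : ℂ) := by
    rw [inner_formOp, inner_self_eq_norm_sq_to_K]
    push_cast
    congr 1
    refine Finset.sum_congr rfl fun v _ => ?_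
    rw [Complex.conj_mul']
  rw [h, Complex.ofReal_re]

/-- A vertex other than the left end of a chosen edge is joined to that end by a walk, whose first
step is an edge at the vertex. Vertex values are therefore controlled by edge functions. -/
theorem exists_vertex_eq [Nonempty E] (v : V) : ∃ e b, Γ.vertex e b = v := by
  obtain ⟨e₀⟩ := ‹Nonempty E›
  by_cases h : Γ.vertex e₀ false = v
  · exact ⟨e₀, false, h⟩
  obtain ⟨p⟩ := Γ.connected.preconnected v (Γ.vertex e₀ false)
  cases p with
  | nil => exact absurd rfl h
  | cons hadj _ =>
    rcases ((SimpleGraph.fromRel_adj _ _ _).1 hadj).2 with ⟨e, h1, h2⟩ | ⟨e, h1, h2⟩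
    · exact ⟨e, false, h1⟩
    · exact ⟨e, true, h2⟩

theorem norm_sq_valL_le [Nonempty E] (u : Γ.FormDomain) (v : V) {ε : ℝ} (hε : 0 < ε) :
    ‖Γ.valL v u‖ ^ 2 ≤ (∑ e, (Γ.length e)⁻¹ + ε⁻¹) * ‖Γ.embL u‖ ^ 2 + ε * ‖Γ.derL u‖ ^ 2 := by
  obtain ⟨e, b, rfl⟩ := Γ.exists_vertex_eq v
  have hl := Γ.length_pos e
  have h1 : ‖Γ.valL (Γ.vertex e b) u‖ ^ 2 ≤ ((Γ.length e)⁻¹ + ε⁻¹) *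
      (∫ x in (0 : ℝ)..Γ.length e, ‖Γ.fn u e x‖ ^ 2) +
      ε * ∫ x in (0 : ℝ)..Γ.length e, ‖Γ.derL u e x‖ ^ 2 := by
    have i := EdgeL2.intervalIntegrable_norm_sq hl.le (Γ.derL u e)
    cases b
    · have := (isPrimitive_fn u e).norm_sq_left_le hl i hε
      rwa [fn_zero, sub_zero] at this
    · have := (isPrimitive_fn u e).norm_sq_right_le hl i hε
      rwa [fn_length, sub_zero] at this
  have hnn : ∀ (f : ℝ → ℂ) (e' : E), 0 ≤ ∫ x in (0 : ℝ)..Γ.length e', ‖f x‖ ^ 2 := fun f e' =>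
    intervalIntegral.integral_nonneg (Γ.length_pos e').le fun x _ => sq_nonneg _
  have h2 : ∫ x in (0 : ℝ)..Γ.length e, ‖Γ.fn u e x‖ ^ 2 ≤ ‖Γ.embL u‖ ^ 2 := by
    rw [norm_sq_embL_eq]
    exact Finset.single_le_sum (f := fun e => ∫ x in (0 : ℝ)..Γ.length e, ‖Γ.fn u e x‖ ^ 2)
      (fun e' _ => hnn _ e') (Finset.mem_univ e)
  have h3 : ∫ x in (0 : ℝ)..Γ.length e, ‖Γ.derL u e x‖ ^ 2 ≤ ‖Γ.derL u‖ ^ 2 := by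
    rw [norm_sq_L2_eq]
    exact Finset.single_le_sum (f := fun e => ∫ x in (0 : ℝ)..Γ.length e, ‖Γ.derL u e x‖ ^ 2)
      (fun e' _ => hnn _ e') (Finset.mem_univ e)
  have h4 : (Γ.length e)⁻¹ ≤ ∑ e, (Γ.length e)⁻¹ :=
    Finset.single_le_sum (f := fun e => (Γ.length e)⁻¹)
      (fun e' _ => (inv_pos.2 (Γ.length_pos e')).le) (Finset.mem_univ e)
  have h5 := hnn (Γ.fn u e) e
  have h6 : (0 : ℝ) ≤ ∑ e, (Γ.length e)⁻¹ + ε⁻¹ :=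
    add_nonneg ((inv_pos.2 hl).le.trans h4) (inv_pos.2 hε).le
  refine h1.trans (add_le_add ?_ (mul_le_mul_of_nonneg_left h3 hε.le))
  exact (mul_le_mul_of_nonneg_right (by linarith) h5).trans (mul_le_mul_of_nonneg_left h2 h6)

/-- The vertex terms, of either sign, are absorbed by a small part of `‖u'‖²` and a large multiple
of the `L²` norm, through the trace estimate. -/
theorem exists_coercive [Nonempty E] (α : V → ℝ) : ∃ κ : ℝ, ∀ u : Γ.FormDomain,
    1 / 2 * ‖u‖ ^ 2 ≤ (⟪Γ.formOp α u, u⟫_ℂ).re + κ * ‖Γ.embL u‖ ^ 2 := by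
  -- The extra `1 / 2` at each vertex pays for the vertex part of `1 / 2 * ‖u‖²`; `ε` is chosen so
  -- that `B * ε ≤ 1 / 2`, leaving half of `‖u'‖²`.
  set B : ℝ := ∑ v, (|α v| + 1 / 2) with hB
  have hB0 : 0 ≤ B := Finset.sum_nonneg fun v _ => by positivity
  set ε : ℝ := 1 / (2 * (B + 1)) with hε
  have hε0 : 0 < ε := by positivity
  set M : ℝ := ∑ e, (Γ.length e)⁻¹ + ε⁻¹ with hM
  refine ⟨B * M, fun u => ?_⟩
  rw [re_inner_formOp, norm_sq_eq_formDomain]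
  have h1 : ∑ v, (|α v| + 1 / 2) * ‖Γ.valL v u‖ ^ 2 ≤
      B * (M * ‖Γ.embL u‖ ^ 2 + ε * ‖Γ.derL u‖ ^ 2) := by
    rw [hB, Finset.sum_mul]
    exact Finset.sum_le_sum fun v _ =>
      mul_le_mul_of_nonneg_left (norm_sq_valL_le u v hε0) (by positivity)
  have h2 : ∑ v, (|α v| + 1 / 2) * ‖Γ.valL v u‖ ^ 2 ≥
      1 / 2 * ∑ v, ‖Γ.valL v u‖ ^ 2 - ∑ v, α v * ‖Γ.valL v u‖ ^ 2 := by
    rw [Finset.mul_sum, ← Finset.sum_sub_distrib]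
    refine Finset.sum_le_sum fun v _ => ?_
    rw [← sub_mul]
    exact mul_le_mul_of_nonneg_right (by linarith [neg_abs_le (α v)]) (sq_nonneg _)
  have h3 : B * ε ≤ 1 / 2 := by
    rw [hε, mul_one_div, div_le_div_iff₀ (by positivity) (by norm_num)]
    linarith
  nlinarith [mul_le_mul_of_nonneg_right h3 (sq_nonneg ‖Γ.derL u‖)]

end MetricGraph

/-! ### Weak eigenvectors are the eigenfunctions of the operator -/

theorem IsPrimitive.congr_ae {l : ℝ} {F f g : ℝ → ℂ} (h : IsPrimitive 0 l F f)
    (hl : 0 ≤ l) (e : f =ᵐ[volume.restrict (Ioo 0 l)] g) : IsPrimitive 0 l F g := by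
  refine ⟨?_, fun x hx => ?_⟩
  · have h1 := h.intervalIntegrable
    rw [intervalIntegrable_iff_integrableOn_Ioo_of_le hl] at h1 ⊢
    exact h1.congr e
  · rw [h.eq x hx, intervalIntegral.integral_of_le hx.1, intervalIntegral.integral_of_le hx.1,
      integral_Ioc_eq_integral_Ioo, integral_Ioc_eq_integral_Ioo]
    congr 1
    exact integral_congr_ae (ae_restrict_of_ae_restrict_of_subset (Ioo_subset_Ioo_right hx.2) e)

namespace MetricGraph

open scoped InnerProductSpace ComplexConjugate
open ContinuousLinearMap

set_option linter.unusedSectionVars false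

variable {V E : Type*} [Fintype V] [Fintype E] {Γ : MetricGraph V E} {α : V → ℝ}

theorem inner_derL_edge (w : Γ.FormDomain) (e : E) {φ' k : ℝ → ℂ}
    (hp : IsPrimitive 0 (Γ.length e) φ' k) :
    ∫ x in (0 : ℝ)..Γ.length e, conj (φ' x) * Γ.derL w e x =
      conj (φ' (Γ.length e)) * Γ.valL (Γ.vertex e true) w -
        conj (φ' 0) * Γ.valL (Γ.vertex e false) w -
        ∫ x in (0 : ℝ)..Γ.length e, conj (k x) * Γ.fn w e x := by
  have hl := (Γ.length_pos e).le
  have hw := isPrimitive_fn w e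
  have h := (hp.conjugate.mul hl hw).integral_eq hl
  have c1 := hp.conjugate.continuousOn hl
  have c2 := hw.continuousOn hl
  rw [← uIcc_of_le hl] at c1 c2
  rw [intervalIntegral.integral_add (hp.conjugate.intervalIntegrable.mul_continuousOn c2)
    (hw.intervalIntegrable.continuousOn_mul c1), fn_length, fn_zero] at h
  linear_combination h

/-- Green's formula. -/
theorem inner_derL_eq (u w : Γ.FormDomain) {φ' k : E → ℝ → ℂ}
    (h : ∀ e, Γ.derL u e =ᵐ[volume.restrict (Ioo 0 (Γ.length e))] φ' e)
    (hp : ∀ e, IsPrimitive 0 (Γ.length e) (φ' e) (k e)) :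
    ⟪Γ.derL u, Γ.derL w⟫_ℂ =
      -∑ p : E × Bool, conj (Γ.inwardDeriv φ' p.1 p.2) * Γ.valL (Γ.vertex p.1 p.2) w -
        ∑ e, ∫ x in (0 : ℝ)..Γ.length e, conj (k e x) * Γ.fn w e x := by
  rw [inner_L2_eq, Fintype.sum_prod_type, ← Finset.sum_neg_distrib, ← Finset.sum_sub_distrib]
  refine Finset.sum_congr rfl fun e _ => ?_
  have h1 : ∫ x in (0 : ℝ)..Γ.length e, conj (Γ.derL u e x) * Γ.derL w e x =
      ∫ x in (0 : ℝ)..Γ.length e, conj (φ' e x) * Γ.derL w e x := by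
    refine intervalIntegral_congr_ae_edge (Γ.length_pos e).le ?_
    filter_upwards [h e] with x hx
    rw [hx]
  rw [h1, inner_derL_edge w e (hp e), Fintype.sum_bool]
  simp only [inwardDeriv, map_neg]
  ring

theorem finsum_fiber_eq (f : E × Bool → ℂ) (v : V) [DecidableEq V] :
    ∑ᶠ p ∈ {p : E × Bool | Γ.vertex p.1 p.2 = v}, f p =
      ∑ p : E × Bool with Γ.vertex p.1 p.2 = v, f p := by
  rw [← finsum_mem_coe_finset]
  simp

/-- Once the differential equation holds on the edges, Green's formula reduces the weak equation to
the defects in the vertex conditions. This serves both directions of `mem_eigenspace_iff_exists`. -/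
theorem inner_formOp_eq (u w : Γ.FormDomain) {φ' : E → ℝ → ℂ} {μ : ℝ}
    (h : ∀ e, Γ.derL u e =ᵐ[volume.restrict (Ioo 0 (Γ.length e))] φ' e)
    (hp : ∀ e, IsPrimitive 0 (Γ.length e) (φ' e) (fun x => -(μ * Γ.fn u e x))) :
    ⟪Γ.formOp α u, w⟫_ℂ = μ * ⟪Γ.embL u, Γ.embL w⟫_ℂ +
      ∑ v, conj (α v * Γ.valL v u -
        ∑ᶠ p ∈ {p : E × Bool | Γ.vertex p.1 p.2 = v}, Γ.inwardDeriv φ' p.1 p.2) *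
          Γ.valL v w := by
  classical
  rw [inner_formOp, inner_derL_eq u w h hp, inner_embL_eq, Finset.mul_sum]
  simp only [finsum_fiber_eq, map_sub, map_mul, Complex.conj_ofReal, sub_mul, map_sum,
    Finset.sum_sub_distrib, map_neg, neg_mul, intervalIntegral.integral_neg,
    Finset.sum_neg_distrib, mul_assoc, intervalIntegral.integral_const_mul, Finset.sum_mul]
  rw [← Finset.sum_fiberwise (s := Finset.univ) (g := fun p : E × Bool => Γ.vertex p.1 p.2)]
  have h1 : ∀ v, ∑ p : E × Bool with Γ.vertex p.1 p.2 = v,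
      conj (Γ.inwardDeriv φ' p.1 p.2) * Γ.valL (Γ.vertex p.1 p.2) w =
      ∑ p : E × Bool with Γ.vertex p.1 p.2 = v, conj (Γ.inwardDeriv φ' p.1 p.2) * Γ.valL v w := fun v =>
    Finset.sum_congr rfl fun p hp => by rw [(Finset.mem_filter.1 hp).2]
  simp only [h1]
  ring

/-- The vertex values of a function in the form domain are arbitrary: interpolate linearly along
the edges. -/
theorem exists_valL_eq (d : V → ℂ) : ∃ w : Γ.FormDomain, ∀ v, Γ.valL v w = d v := by
  let g : Γ.L2 := WithLp.toLp 2 fun e =>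
    ((Γ.length e : ℂ)⁻¹ * (d (Γ.vertex e true) - d (Γ.vertex e false))) •
      EdgeL2.indicator (Γ.length e) (Γ.length e)
  refine ⟨mkForm d g fun e => ?_, fun v => rfl⟩
  have hl := Γ.length_pos e
  rw [← EdgeL2.inner_indicator (right_mem_Icc.2 hl.le)]
  change ⟪EdgeL2.indicator (Γ.length e) (Γ.length e), ((Γ.length e : ℂ)⁻¹ *
    (d (Γ.vertex e true) - d (Γ.vertex e false))) •
      EdgeL2.indicator (Γ.length e) (Γ.length e)⟫_ℂ = _
  rw [inner_smul_right, EdgeL2.inner_indicator (right_mem_Icc.2 hl.le),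
    EdgeL2.integral_congr _ (EdgeL2.indicator_ae_eq _) (right_mem_Icc.2 hl.le)]
  have : (Γ.length e : ℂ) ≠ 0 := by exact_mod_cast hl.ne'
  simp
  field_simp

/-- An element of `L²(0, l)` orthogonal to all elements of mean zero is constant. -/
theorem _root_.EdgeL2.eq_const_of_orthogonal {l : ℝ} (hl : 0 < l) (G : EdgeL2 l)
    (h : ∀ g : EdgeL2 l, ∫ t in (0 : ℝ)..l, g t = 0 → ⟪G, g⟫_ℂ = 0) :
    ∃ k : ℂ, G = k • EdgeL2.indicator l l := by
  have hr := right_mem_Icc.2 hl.le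
  have hl' : (l : ℂ) ≠ 0 := by exact_mod_cast hl.ne'
  have h11 : ⟪EdgeL2.indicator l l, EdgeL2.indicator l l⟫_ℂ = l := by
    rw [EdgeL2.inner_indicator hr, EdgeL2.integral_congr _ (EdgeL2.indicator_ae_eq _) hr]
    simp
  set k : ℂ := (l : ℂ)⁻¹ * ⟪EdgeL2.indicator l l, G⟫_ℂ with hk
  have h0 : ⟪EdgeL2.indicator l l, G - k • EdgeL2.indicator l l⟫_ℂ = 0 := by
    rw [inner_sub_right, inner_smul_right, h11, hk]
    field_simp
    simp
  have h1 := h (G - k • EdgeL2.indicator l l) (by rw [← EdgeL2.inner_indicator hr, h0])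
  refine ⟨k, sub_eq_zero.1 ((inner_self_eq_zero (𝕜 := ℂ)).1 ?_)⟩
  rw [inner_sub_left (G), h1, inner_smul_left, h0, mul_zero, sub_zero]

/-- The weak eigenvectors on `Γ` satisfy the differential equation on every edge. -/
theorem exists_derivative_of_mem_formEigenspace {μ : ℝ} {u : Γ.FormDomain}
    (hu : u ∈ formEigenspace (Γ.formOp α) Γ.embL μ) (e : E) :
    ∃ φ' : ℝ → ℂ, Γ.derL u e =ᵐ[volume.restrict (Ioo 0 (Γ.length e))] φ' ∧
      IsPrimitive 0 (Γ.length e) φ' (fun x => -(μ * Γ.fn u e x)) := by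
  classical
  have hl := Γ.length_pos e
  have hc := continuousOn_fn u e
  have hfi : IntervalIntegrable (Γ.fn u e) volume 0 (Γ.length e) :=
    (by rwa [uIcc_of_le hl.le] : ContinuousOn _ (uIcc 0 (Γ.length e))).intervalIntegrable
  have hΦ : IsPrimitive 0 (Γ.length e) (fun x => ∫ t in (0 : ℝ)..x, Γ.fn u e t) (Γ.fn u e) :=
    ⟨hfi, fun x _ => by simp⟩
  have hm := EdgeL2.memLp_of_continuousOn (hΦ.continuousOn hl.le)
  -- The integrated equation: `u' + μ ∫ u` should be constant. It is tested with functions that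
  -- vanish at all vertices and have a derivative `g` of mean zero, supported on `e`.
  let G : EdgeL2 (Γ.length e) := Γ.derL u e + (μ : ℂ) • hm.toLp _
  obtain ⟨k, hk⟩ := EdgeL2.eq_const_of_orthogonal hl G (by
    intro g hg
    let w : Γ.FormDomain := mkForm 0 (WithLp.toLp 2 (Pi.single e g)) (by
      intro e'
      by_cases he : e' = e
      · subst he
        simpa using hg
      · have h1 : (WithLp.toLp 2 (Pi.single e g) : Γ.L2) e' = 0 := by
          change Pi.single (M := fun e => EdgeL2 (Γ.length e)) e g e' = 0
          rw [Pi.single_eq_of_ne he]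
        rw [h1, ← EdgeL2.inner_indicator (right_mem_Icc.2 (Γ.length_pos e').le), inner_zero_right]
        simp)
    have hval : ∀ v, Γ.valL v w = 0 := fun v => rfl
    have hdere : Γ.derL w e = g := by
      change Pi.single (M := fun e => EdgeL2 (Γ.length e)) e g e = g
      rw [Pi.single_eq_same]
    have hder : ∀ e', e' ≠ e → Γ.derL w e' = 0 := fun e' he => by
      change Pi.single (M := fun e => EdgeL2 (Γ.length e)) e g e' = 0
      rw [Pi.single_eq_of_ne he]
    have h1 := mem_formEigenspace_iff_inner.1 hu w
    rw [inner_formOp, PiLp.inner_apply, Finset.sum_eq_single e, hdere] at h1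
    rotate_left
    · intro e' _ he
      rw [hder e' he, inner_zero_right]
    · simp
    simp only [hval, mul_zero, Finset.sum_const_zero, add_zero] at h1
    rw [inner_embL_eq, Finset.sum_eq_single e] at h1
    rotate_left
    · intro e' _ he
      have hz : ∀ x ∈ Icc 0 (Γ.length e'), Γ.fn w e' x = 0 := fun x hx => by
        rw [fn, hder e' he, ← EdgeL2.inner_indicator hx, inner_zero_right, hval, add_zero]
      rw [intervalIntegral.integral_congr (g := fun _ => 0), intervalIntegral.integral_zero]
      intro x hx
      rw [uIcc_of_le (Γ.length_pos e').le] at hx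
      change conj (Γ.fn u e' x) * Γ.fn w e' x = 0
      rw [hz x hx, mul_zero]
    · simp
    have h2 := inner_derL_edge w e hΦ
    rw [hval, hval, hdere] at h2
    have h3 : ⟪hm.toLp _, g⟫_ℂ =
        ∫ x in (0 : ℝ)..Γ.length e, conj (∫ t in (0 : ℝ)..x, Γ.fn u e t) * g x := by
      rw [EdgeL2.inner_eq hl.le]
      refine intervalIntegral_congr_ae_edge hl.le ?_
      filter_upwards [hm.coeFn_toLp] with x hx
      rw [hx]
    rw [inner_add_left, inner_smul_left, h1, h3, h2, Complex.conj_ofReal]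
    ring)
  refine ⟨fun x => k - μ * ∫ t in (0 : ℝ)..x, Γ.fn u e t, ?_, ?_, ?_⟩
  · have h4 : Γ.derL u e = k • EdgeL2.indicator (Γ.length e) (Γ.length e) -
        (μ : ℂ) • hm.toLp _ := by rw [← hk]; simp [G]
    rw [h4]
    filter_upwards [Lp.coeFn_sub (k • EdgeL2.indicator (Γ.length e) (Γ.length e))
        ((μ : ℂ) • hm.toLp _), Lp.coeFn_smul (μ : ℂ) (hm.toLp _),
      Lp.coeFn_smul k (EdgeL2.indicator (Γ.length e) (Γ.length e)),
      EdgeL2.indicator_ae_eq (Γ.length e), hm.coeFn_toLp] with x h1 h2 h3 h4 h5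
    rw [h1, Pi.sub_apply, h2, h3, Pi.smul_apply, Pi.smul_apply, h4, h5]
    simp
  · exact (hfi.const_mul (μ : ℂ)).neg
  · intro x hx
    simp only [intervalIntegral.integral_same, intervalIntegral.integral_neg,
      intervalIntegral.integral_const_mul]
    ring

/-- A classical eigenfunction satisfies the weak equation by Green's formula. Conversely, tests
supported in one edge give the differential equation, and tests with prescribed vertex values give
the vertex conditions. -/
theorem mem_eigenspace_iff_exists {μ : ℝ} {f : Γ.L2} :
    f ∈ Γ.eigenspace α μ ↔ ∃ u ∈ formEigenspace (Γ.formOp α) Γ.embL μ, Γ.embL u = f := by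
  classical
  rw [eigenspace, Submodule.mem_comap, deltaLaplacian_graph, mem_deltaGraph]
  constructor
  · rintro ⟨φ, φ', h, c, hc, hs⟩
    have hf : ∀ e, f e =ᵐ[volume.restrict (Ioo 0 (Γ.length e))] φ e := fun e => (h e).1
    have hφ : ∀ e, IsPrimitive 0 (Γ.length e) (φ e) (φ' e) := fun e =>
      (h e).2.2.2.1.isPrimitive (Γ.length_pos e) (h e).2.1
    have hm : ∀ e, MemLp (φ' e) 2 (volume.restrict (Ioo 0 (Γ.length e))) := fun e =>
      EdgeL2.memLp_of_continuousOn (h e).2.2.1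
    let u : Γ.FormDomain := mkForm c (WithLp.toLp 2 fun e => (hm e).toLp _) fun e => by
      rw [EdgeL2.integral_congr _ (hm e).coeFn_toLp (right_mem_Icc.2 (Γ.length_pos e).le),
        (hφ e).integral_eq (Γ.length_pos e).le, ← hc e true, ← hc e false]
      rfl
    have hder : ∀ e, Γ.derL u e =ᵐ[volume.restrict (Ioo 0 (Γ.length e))] φ' e := fun e =>
      (hm e).coeFn_toLp
    have hfn : ∀ e, ∀ x ∈ Icc 0 (Γ.length e), Γ.fn u e x = φ e x := fun e x hx => by
      rw [(hφ e).eq x hx, fn, EdgeL2.integral_congr _ (hder e) hx]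
      congr 1
      exact (hc e false).symm
    have hfn' : ∀ e, f e =ᵐ[volume.restrict (Ioo 0 (Γ.length e))] Γ.fn u e := fun e => by
      filter_upwards [hf e, ae_restrict_mem measurableSet_Ioo] with x hx hx'
      rw [hx, hfn e x (Ioo_subset_Icc_self hx')]
    refine ⟨u, mem_formEigenspace_iff_inner.2 fun w => ?_, ?_⟩
    · rw [inner_formOp_eq u w hder (μ := μ) fun e => ?_]
      · rw [Finset.sum_eq_zero, add_zero]
        intro v _
        rw [hs v]
        change conj ((α v : ℂ) * c v - α v * c v) * _ = 0
        simp
      · refine ((h e).2.2.2.2.isPrimitive (Γ.length_pos e) (h e).2.2.1).congr_ae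
          (Γ.length_pos e).le ?_
        filter_upwards [hfn' e, Lp.coeFn_smul (μ : ℂ) (f e)] with x h1 h2
        rw [← h1]
        congr 1
    · ext1 e
      refine Lp.ext ?_
      exact (embL_ae_eq u e).trans (hfn' e).symm
  · rintro ⟨u, hu, rfl⟩
    choose φ' h1 h2 using exists_derivative_of_mem_formEigenspace hu
    have hφ : ∀ e, IsPrimitive 0 (Γ.length e) (Γ.fn u e) (φ' e) := fun e =>
      (isPrimitive_fn u e).congr_ae (Γ.length_pos e).le (h1 e)
    refine ⟨Γ.fn u, φ', fun e => ⟨embL_ae_eq u e, continuousOn_fn u e,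
      (h2 e).continuousOn (Γ.length_pos e).le, (hφ e).hasWeakDeriv (Γ.length_pos e).le,
      ((h2 e).hasWeakDeriv (Γ.length_pos e).le).congr ?_⟩,
      fun v => Γ.valL v u, fn_endpoint u, fun v => ?_⟩
    · filter_upwards [embL_ae_eq u e, Lp.coeFn_smul (μ : ℂ) (Γ.embL u e)] with x h3 h4
      rw [← h3]
      congr 1
      exact h4.symm
    -- A test function equal to `1` at `v` and `0` at the other vertices isolates the defect at `v`.
    · obtain ⟨w, hw⟩ := exists_valL_eq (Γ := Γ) (Pi.single v 1)
      have h3 := inner_formOp_eq (α := α) u w h1 h2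
      rw [mem_formEigenspace_iff_inner.1 hu, left_eq_add, Finset.sum_eq_single v, hw,
        Pi.single_eq_same, mul_one, map_eq_zero, sub_eq_zero] at h3
      · exact h3.symm
      · intro v' _ hv
        rw [hw, Pi.single_eq_of_ne hv, mul_zero]
      · simp

end MetricGraph

/-! ### Orthogonal sums and trigonometric integrals -/

open scoped InnerProductSpace ComplexConjugate in
theorem norm_sq_sum_smul_of_orthogonal {ι K : Type*} [Fintype ι] [NormedAddCommGroup K]
    [InnerProductSpace ℂ K] {v : ι → K} (h : ∀ i j, i ≠ j → ⟪v i, v j⟫_ℂ = 0) (β : ι → ℂ) :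
    ‖∑ i, β i • v i‖ ^ 2 = ∑ i, ‖β i‖ ^ 2 * ‖v i‖ ^ 2 := by
  have h1 : ⟪∑ i, β i • v i, ∑ i, β i • v i⟫_ℂ = ((∑ i, ‖β i‖ ^ 2 * ‖v i‖ ^ 2 : ℝ) : ℂ) := by
    simp only [sum_inner, inner_sum, inner_smul_left, inner_smul_right]
    rw [Complex.ofReal_sum]
    refine Finset.sum_congr rfl fun i _ => ?_
    rw [Finset.sum_eq_single i]
    · rw [inner_self_eq_norm_sq_to_K, ← mul_assoc, Complex.mul_conj']
      push_cast
      rfl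
    · intro j _ hj
      rw [h j i hj, mul_zero]
    · simp
  rw [inner_self_eq_norm_sq_to_K] at h1
  exact Complex.ofReal_injective ((Complex.ofReal_pow _ _).trans h1)

section Trigonometric

variable {l : ℝ}

theorem integral_cos_int_mul (hl : 0 < l) {m : ℤ} (hm : m ≠ 0) :
    ∫ x in (0 : ℝ)..l, Real.cos (m * Real.pi / l * x) = 0 := by
  have hm' : (m : ℝ) ≠ 0 := by exact_mod_cast hm
  have hne : (m : ℝ) * Real.pi / l ≠ 0 :=
    div_ne_zero (mul_ne_zero hm' Real.pi_ne_zero) hl.ne'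
  rw [intervalIntegral.integral_comp_mul_left (fun x => Real.cos x) hne, integral_cos,
    div_mul_cancel₀ _ hl.ne', mul_zero, Real.sin_zero, Real.sin_int_mul_pi]
  simp

theorem integral_cos_mul_cos_and_sin_mul_sin (hl : 0 < l) (p q : ℕ) (hp : 0 < p) :
    ∫ x in (0 : ℝ)..l, Real.cos (p * Real.pi / l * x) * Real.cos (q * Real.pi / l * x) =
        (if p = q then l / 2 else 0) ∧
      ∫ x in (0 : ℝ)..l, Real.sin (p * Real.pi / l * x) * Real.sin (q * Real.pi / l * x) =
        (if p = q then l / 2 else 0) := by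
  have hc : ∀ m : ℤ, IntervalIntegrable (fun x => Real.cos (m * Real.pi / l * x)) volume 0 l :=
    fun m => Continuous.intervalIntegrable (by fun_prop) _ _
  have h1 : ∀ x : ℝ, Real.cos (p * Real.pi / l * x) * Real.cos (q * Real.pi / l * x) =
      2⁻¹ * (Real.cos (((p : ℤ) - (q : ℤ) : ℤ) * Real.pi / l * x) +
        Real.cos (((p : ℤ) + (q : ℤ) : ℤ) * Real.pi / l * x)) := fun x => by
    push_cast
    rw [show ((p : ℝ) - q) * Real.pi / l * x = p * Real.pi / l * x - q * Real.pi / l * x by ring,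
      show ((p : ℝ) + q) * Real.pi / l * x = p * Real.pi / l * x + q * Real.pi / l * x by ring,
      Real.cos_sub, Real.cos_add]
    ring
  have h2 : ∀ x : ℝ, Real.sin (p * Real.pi / l * x) * Real.sin (q * Real.pi / l * x) =
      2⁻¹ * (Real.cos (((p : ℤ) - (q : ℤ) : ℤ) * Real.pi / l * x) -
        Real.cos (((p : ℤ) + (q : ℤ) : ℤ) * Real.pi / l * x)) := fun x => by
    push_cast
    rw [show ((p : ℝ) - q) * Real.pi / l * x = p * Real.pi / l * x - q * Real.pi / l * x by ring,
      show ((p : ℝ) + q) * Real.pi / l * x = p * Real.pi / l * x + q * Real.pi / l * x by ring,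
      Real.cos_sub, Real.cos_add]
    ring
  -- Positivity of `p` excludes the frequency `p + q = 0`.
  have h3 : ∫ x in (0 : ℝ)..l, Real.cos (((p : ℤ) + (q : ℤ) : ℤ) * Real.pi / l * x) = 0 :=
    integral_cos_int_mul hl (by omega)
  have h4 : ∫ x in (0 : ℝ)..l, Real.cos (((p : ℤ) - (q : ℤ) : ℤ) * Real.pi / l * x) =
      if p = q then l else 0 := by
    split_ifs with h
    · simp [h]
    · exact integral_cos_int_mul hl (by omega)
  simp only [h1, h2, intervalIntegral.integral_const_mul]
  rw [intervalIntegral.integral_add (hc _) (hc _), intervalIntegral.integral_sub (hc _) (hc _),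
    h3, h4]
  split_ifs <;> constructor <;> ring

end Trigonometric

/-! ### Dirichlet test functions, point conditions and compactness -/

namespace MetricGraph

open scoped InnerProductSpace ComplexConjugate
open ContinuousLinearMap

set_option linter.unusedSectionVars false

variable {V E : Type*} [Fintype V] [Fintype E] {Γ : MetricGraph V E} {α : V → ℝ}

section Sine

variable (Γ)

/-- The frequency of the `p`-th Dirichlet eigenfunction of the edge `e`. -/
def freq (e : E) (p : ℕ) : ℝ := p * Real.pi / Γ.length e

theorem memLp_cos (e : E) (p : ℕ) :
    MemLp (fun x : ℝ => ((Γ.freq e p * Real.cos (Γ.freq e p * x) : ℝ) : ℂ)) 2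
      (volume.restrict (Ioo 0 (Γ.length e))) :=
  EdgeL2.memLp_of_continuousOn (Continuous.continuousOn (by fun_prop))

variable [DecidableEq E]

/-- The derivative of the `p`-th Dirichlet eigenfunction of the edge `e`. -/
def cosVec (e : E) (p : ℕ) : Γ.L2 :=
  WithLp.toLp 2 (Pi.single (M := fun e => EdgeL2 (Γ.length e)) e ((Γ.memLp_cos e p).toLp _))

variable {Γ}

theorem cosVec_of_ne {e e' : E} (h : e' ≠ e) (p : ℕ) : Γ.cosVec e p e' = 0 :=
  Pi.single_eq_of_ne h _

theorem cosVec_ae_eq (e : E) (p : ℕ) :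
    Γ.cosVec e p e =ᵐ[volume.restrict (Ioo 0 (Γ.length e))]
      fun x => ((Γ.freq e p * Real.cos (Γ.freq e p * x) : ℝ) : ℂ) := by
  have h : Γ.cosVec e p e = (Γ.memLp_cos e p).toLp _ := Pi.single_eq_same _ _
  rw [h]
  exact (Γ.memLp_cos e p).coeFn_toLp

theorem integral_cosVec (e : E) (p : ℕ) {x : ℝ} (hx : x ∈ Icc 0 (Γ.length e)) :
    ∫ t in (0 : ℝ)..x, Γ.cosVec e p e t = ((Real.sin (Γ.freq e p * x) : ℝ) : ℂ) := by
  rw [EdgeL2.integral_congr _ (cosVec_ae_eq e p) hx, intervalIntegral.integral_ofReal]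
  congr 1
  rw [intervalIntegral.integral_eq_sub_of_hasDerivAt (f := fun t => Real.sin (Γ.freq e p * t))]
  · simp
  · intro t _
    exact ((hasDerivAt_id' t).const_mul _).sin.congr_deriv (by ring)
  · exact Continuous.intervalIntegrable (by fun_prop) _ _

/-- The `p`-th Dirichlet eigenfunction of the edge `e`, extended by zero. -/
def sinVec (e : E) (p : ℕ) : Γ.FormDomain :=
  mkForm 0 (Γ.cosVec e p) fun e' => by
    by_cases h : e' = e
    · subst h
      rw [integral_cosVec _ _ (right_mem_Icc.2 (Γ.length_pos e').le), freq,
        div_mul_cancel₀ _ (Γ.length_pos e').ne', Real.sin_nat_mul_pi]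
      simp
    · rw [cosVec_of_ne h, ← EdgeL2.inner_indicator (right_mem_Icc.2 (Γ.length_pos e').le),
        inner_zero_right]
      simp

theorem valL_sinVec (e : E) (p : ℕ) (v : V) : Γ.valL v (sinVec e p) = 0 := rfl

theorem derL_sinVec (e : E) (p : ℕ) : Γ.derL (sinVec e p) = Γ.cosVec e p := rfl

theorem fn_sinVec (e : E) (p : ℕ) {x : ℝ} (hx : x ∈ Icc 0 (Γ.length e)) :
    Γ.fn (sinVec e p) e x = ((Real.sin (Γ.freq e p * x) : ℝ) : ℂ) := by
  rw [fn, valL_sinVec, zero_add, derL_sinVec, integral_cosVec e p hx]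

theorem fn_sinVec_of_ne {e e' : E} (h : e' ≠ e) (p : ℕ) {x : ℝ} (hx : x ∈ Icc 0 (Γ.length e')) :
    Γ.fn (sinVec e p) e' x = 0 := by
  rw [fn, valL_sinVec, zero_add, derL_sinVec, cosVec_of_ne h, ← EdgeL2.inner_indicator hx,
    inner_zero_right]

theorem inner_cosVec (e : E) (p q : ℕ) (hp : 0 < p) :
    ⟪Γ.cosVec e p, Γ.cosVec e q⟫_ℂ =
      ((Γ.freq e p * Γ.freq e q * (if p = q then Γ.length e / 2 else 0) : ℝ) : ℂ) := by
  rw [inner_L2_eq, Finset.sum_eq_single e]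
  · rw [← (integral_cos_mul_cos_and_sin_mul_sin (Γ.length_pos e) p q hp).1,
      ← intervalIntegral.integral_const_mul, ← intervalIntegral.integral_ofReal]
    refine intervalIntegral_congr_ae_edge (Γ.length_pos e).le ?_
    filter_upwards [cosVec_ae_eq e p, cosVec_ae_eq e q] with x h1 h2
    rw [h1, h2, Complex.conj_ofReal, ← Complex.ofReal_mul]
    simp only [freq]
    congr 1
    ring
  · intro e' _ he
    have : Γ.cosVec e q e' = 0 := cosVec_of_ne he q
    rw [← EdgeL2.inner_eq (Γ.length_pos e').le, this, inner_zero_right]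
  · simp

theorem inner_cosVec_of_ne {e e' : E} (h : e ≠ e') (p q : ℕ) :
    ⟪Γ.cosVec e p, Γ.cosVec e' q⟫_ℂ = 0 := by
  rw [PiLp.inner_apply]
  refine Finset.sum_eq_zero fun i _ => ?_
  by_cases hi : i = e
  · have : Γ.cosVec e' q i = 0 := cosVec_of_ne (by rwa [hi]) q
    rw [this, inner_zero_right]
  · have : Γ.cosVec e p i = 0 := cosVec_of_ne hi p
    rw [this, inner_zero_left]

theorem inner_embL_sinVec (e : E) (p q : ℕ) (hp : 0 < p) :
    ⟪Γ.embL (sinVec e p), Γ.embL (sinVec e q)⟫_ℂ =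
      ((if p = q then Γ.length e / 2 else 0 : ℝ) : ℂ) := by
  rw [inner_embL_eq, Finset.sum_eq_single e]
  · rw [← (integral_cos_mul_cos_and_sin_mul_sin (Γ.length_pos e) p q hp).2,
      ← intervalIntegral.integral_ofReal]
    refine intervalIntegral.integral_congr fun x hx => ?_
    rw [uIcc_of_le (Γ.length_pos e).le] at hx
    rw [fn_sinVec e p hx, fn_sinVec e q hx, Complex.conj_ofReal, ← Complex.ofReal_mul]
    rfl
  · intro e' _ he
    rw [intervalIntegral.integral_congr (g := fun _ => 0), intervalIntegral.integral_zero]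
    intro x hx
    rw [uIcc_of_le (Γ.length_pos e').le] at hx
    change conj (Γ.fn (sinVec e p) e' x) * Γ.fn (sinVec e q) e' x = 0
    rw [fn_sinVec_of_ne he q hx, mul_zero]
  · simp

theorem inner_embL_sinVec_of_ne {e e' : E} (h : e ≠ e') (p q : ℕ) :
    ⟪Γ.embL (sinVec e p), Γ.embL (sinVec e' q)⟫_ℂ = 0 := by
  rw [inner_embL_eq]
  refine Finset.sum_eq_zero fun i _ => ?_
  rw [intervalIntegral.integral_congr (g := fun _ => 0), intervalIntegral.integral_zero]
  intro x hx
  rw [uIcc_of_le (Γ.length_pos i).le] at hx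
  change conj (Γ.fn (sinVec e p) i x) * Γ.fn (sinVec e' q) i x = 0
  by_cases hi : i = e
  · rw [fn_sinVec_of_ne (e := e') (by rwa [hi]) q hx, mul_zero]
  · rw [fn_sinVec_of_ne hi p hx, map_zero, zero_mul]

end Sine

/-- The span of the first `n e` Dirichlet eigenfunctions of each edge `e`. -/
theorem exists_dirichlet_testSpace {n : E → ℕ} {s : ℝ}
    (hn : ∀ e, n e * Real.pi ≤ s * Γ.length e) :
    ∃ Ψ : ((Σ e, Fin (n e)) → ℂ) →ₗ[ℂ] Γ.FormDomain, Function.Injective Ψ ∧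
      ∀ β, (⟪Γ.formOp α (Ψ β), Ψ β⟫_ℂ).re ≤ s ^ 2 * ‖Γ.embL (Ψ β)‖ ^ 2 := by
  classical
  -- The shift by one skips the zero function at `p = 0`.
  let w : (Σ e, Fin (n e)) → Γ.FormDomain := fun i => sinVec i.1 (i.2 + 1)
  let Ψ : ((Σ e, Fin (n e)) → ℂ) →ₗ[ℂ] Γ.FormDomain := Fintype.linearCombination ℂ w
  have hΨ : ∀ β, Ψ β = ∑ i, β i • w i := fun β => Fintype.linearCombination_apply ℂ w β
  have hne : ∀ i j : Σ e, Fin (n e), i ≠ j → i.1 = j.1 → (i.2 : ℕ) ≠ j.2 := by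
    rintro ⟨e, i⟩ ⟨e', j⟩ hij h h'
    obtain rfl : e = e' := h
    obtain rfl : i = j := Fin.ext h'
    exact hij rfl
  have o1 : ∀ i j, i ≠ j → ⟪Γ.embL (w i), Γ.embL (w j)⟫_ℂ = 0 := by
    intro i j hij
    by_cases h : i.1 = j.1
    · have := hne i j hij h
      simp only [w, ← h]
      rw [inner_embL_sinVec _ _ _ (Nat.succ_pos _), if_neg (by omega), Complex.ofReal_zero]
    · exact inner_embL_sinVec_of_ne h _ _
  have o2 : ∀ i j, i ≠ j → ⟪Γ.derL (w i), Γ.derL (w j)⟫_ℂ = 0 := by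
    intro i j hij
    by_cases h : i.1 = j.1
    · have := hne i j hij h
      simp only [w, ← h, derL_sinVec]
      rw [inner_cosVec _ _ _ (Nat.succ_pos _), if_neg (by omega), mul_zero, Complex.ofReal_zero]
    · exact inner_cosVec_of_ne h _ _
  have n1 : ∀ i, ‖Γ.embL (w i)‖ ^ 2 = Γ.length i.1 / 2 := by
    intro i
    have h := inner_embL_sinVec (Γ := Γ) i.1 (i.2 + 1) (i.2 + 1) (Nat.succ_pos _)
    rw [inner_self_eq_norm_sq_to_K, if_pos rfl] at h
    exact Complex.ofReal_injective ((Complex.ofReal_pow _ _).trans h)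
  have n2 : ∀ i, ‖Γ.derL (w i)‖ ^ 2 = Γ.freq i.1 (i.2 + 1) ^ 2 * (Γ.length i.1 / 2) := by
    intro i
    have h := inner_cosVec (Γ := Γ) i.1 (i.2 + 1) (i.2 + 1) (Nat.succ_pos _)
    rw [inner_self_eq_norm_sq_to_K, if_pos rfl, ← sq] at h
    exact Complex.ofReal_injective ((Complex.ofReal_pow _ _).trans h)
  have e1 : ∀ β, ‖Γ.embL (Ψ β)‖ ^ 2 = ∑ i, ‖β i‖ ^ 2 * (Γ.length i.1 / 2) := by
    intro β
    rw [hΨ, map_sum]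
    simp only [map_smul]
    rw [norm_sq_sum_smul_of_orthogonal o1]
    simp only [n1]
  refine ⟨Ψ, ?_, fun β => ?_⟩
  · rw [← LinearMap.ker_eq_bot, LinearMap.ker_eq_bot']
    intro β hβ
    have h := e1 β
    rw [hβ, map_zero, norm_zero, zero_pow two_ne_zero, eq_comm, Finset.sum_eq_zero_iff_of_nonneg
      fun i _ => mul_nonneg (sq_nonneg _) (half_pos (Γ.length_pos i.1)).le] at h
    funext i
    have := h i (Finset.mem_univ i)
    simpa [(Γ.length_pos i.1).ne'] using this
  · rw [re_inner_formOp, e1]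
    -- The strengths `α` drop out of the form here.
    have hv : ∀ v, Γ.valL v (Ψ β) = 0 := by
      intro v
      rw [hΨ, map_sum]
      refine Finset.sum_eq_zero fun i _ => ?_
      rw [map_smul, valL_sinVec, smul_zero]
    simp only [hv, norm_zero, ne_eq, OfNat.ofNat_ne_zero, not_false_eq_true, zero_pow, mul_zero,
      Finset.sum_const_zero, add_zero]
    rw [hΨ, map_sum]
    simp only [map_smul]
    rw [norm_sq_sum_smul_of_orthogonal o2, Finset.mul_sum]
    refine Finset.sum_le_sum fun i _ => ?_
    rw [n2]
    have hl := Γ.length_pos i.1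
    have h1 : Γ.freq i.1 (i.2 + 1) ≤ s := by
      rw [freq, div_le_iff₀ hl]
      refine le_trans ?_ (hn i.1)
      have : (i.2 : ℕ) + 1 ≤ n i.1 := i.2.2
      exact mul_le_mul_of_nonneg_right (by exact_mod_cast this) Real.pi_pos.le
    have h0 : 0 ≤ Γ.freq i.1 (i.2 + 1) := by
      rw [freq]
      positivity
    have h2 : Γ.freq i.1 (i.2 + 1) ^ 2 ≤ s ^ 2 := pow_le_pow_left₀ h0 h1 2
    calc ‖β i‖ ^ 2 * (Γ.freq i.1 (i.2 + 1) ^ 2 * (Γ.length i.1 / 2))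
        ≤ ‖β i‖ ^ 2 * (s ^ 2 * (Γ.length i.1 / 2)) := by gcongr
      _ = _ := by ring

/-- The evaluations at the vertices and at `n e` equidistant interior points of each edge `e`. -/
def evalPoints (Γ : MetricGraph V E) (n : E → ℕ) :
    V ⊕ (Σ e, Fin (n e)) → Γ.FormDomain →L[ℂ] ℂ :=
  Sum.elim Γ.valL fun i => Γ.evalL i.1 (Γ.length i.1 * ((i.2 + 1 : ℕ) : ℝ) / (n i.1 + 1))

/-- The vertices and the interior points cut edge `e` into `n e + 1` equal pieces with `u` zero at
all ends, so `wirtinger_subdivision` applies edge by edge. -/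
theorem sq_mul_norm_embL_le {n : E → ℕ} {c : ℝ} (hc : 0 ≤ c)
    (hn : ∀ e, c * Γ.length e < Real.pi * (n e + 1)) {u : Γ.FormDomain}
    (hu : ∀ i, Γ.evalPoints n i u = 0) :
    c ^ 2 * ‖Γ.embL u‖ ^ 2 ≤ ‖Γ.derL u‖ ^ 2 := by
  rw [norm_sq_embL_eq, norm_sq_L2_eq, Finset.mul_sum]
  have hv : ∀ v, Γ.valL v u = 0 := fun v => hu (Sum.inl v)
  refine Finset.sum_le_sum fun e _ => ?_
  have hl := Γ.length_pos e
  refine (isPrimitive_fn u e).wirtinger_subdivision hl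
    (EdgeL2.intervalIntegrable_norm_sq hl.le _) (n e) (fun j hj => ?_) hc (hn e)
  have hn0 : (0 : ℝ) < n e + 1 := by positivity
  rcases j with _ | j
  · rw [Nat.cast_zero, mul_zero, zero_div, fn_zero, hv]
  · rcases Nat.lt_or_ge j (n e) with h | h
    · rw [← evalL_apply u e]
      · exact hu (Sum.inr ⟨e, ⟨j, h⟩⟩)
      · refine ⟨by positivity, ?_⟩
        rw [div_le_iff₀ hn0]
        exact mul_le_mul_of_nonneg_left (by exact_mod_cast hj) hl.le
    · obtain rfl : j = n e := by omega
      have : Γ.length e * ((n e + 1 : ℕ) : ℝ) / ((n e : ℝ) + 1) = Γ.length e := by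
        push_cast
        field_simp
      rw [this, fn_length, hv]

theorem norm_derL_le (u : Γ.FormDomain) : ‖Γ.derL u‖ ≤ ‖u‖ := by
  refine (sq_le_sq₀ (norm_nonneg _) (norm_nonneg _)).1 ?_
  rw [norm_sq_eq_formDomain u]
  exact le_add_of_nonneg_left (Finset.sum_nonneg fun v _ => sq_nonneg _)

/-- With `c = ε⁻¹` the previous estimate makes the embedding `ε`-small on the common kernel of
finitely many evaluations. -/
theorem isCompactOperator_embL : IsCompactOperator Γ.embL := by
  refine isCompactOperator_of_small_on_ker fun ε hε => ?_
  let n : E → ℕ := fun e => ⌊ε⁻¹ * Γ.length e / Real.pi⌋₊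
  let eq := Fintype.equivFin (V ⊕ (Σ e, Fin (n e)))
  refine ⟨_, ContinuousLinearMap.pi fun i => Γ.evalPoints n (eq.symm i), fun u hu => ?_⟩
  have h := sq_mul_norm_embL_le (Γ := Γ) (n := n) (c := ε⁻¹) (inv_pos.2 hε).le (fun e => by
    rw [mul_comm Real.pi, ← div_lt_iff₀ Real.pi_pos]
    exact Nat.lt_floor_add_one _) (u := u) (fun i => by
    have := congrFun hu (eq i)
    simpa using this)
  rw [← mul_pow] at h
  have h1 := (sq_le_sq₀ (by positivity) (norm_nonneg _)).1 h
  rw [inv_mul_le_iff₀ hε] at h1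
  exact h1.trans (mul_le_mul_of_nonneg_left (norm_derL_le u) hε.le)

end MetricGraph

/-! ### Counting eigenvalues of the graph -/

namespace MetricGraph

open scoped InnerProductSpace
open Module

set_option linter.unusedSectionVars false

variable {V E : Type*} [Fintype V] [Fintype E] [Nonempty E] {Γ : MetricGraph V E} {α : V → ℝ}

/-- The map is the embedding itself; coercivity makes it injective on eigenvectors. -/
theorem nonempty_formEigenspace_equiv_eigenspace (μ : ℝ) :
    Nonempty (formEigenspace (Γ.formOp α) Γ.embL μ ≃ₗ[ℂ] Γ.eigenspace α μ) := by
  obtain ⟨κ, hκ⟩ := Γ.exists_coercive α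
  let F : formEigenspace (Γ.formOp α) Γ.embL μ →ₗ[ℂ] Γ.eigenspace α μ :=
    (Γ.embL : Γ.FormDomain →ₗ[ℂ] Γ.L2).restrict
      fun u hu => mem_eigenspace_iff_exists.2 ⟨u, hu, rfl⟩
  refine ⟨LinearEquiv.ofBijective F ⟨?_, ?_⟩⟩
  · refine (injective_iff_map_eq_zero F).2 fun u hu => Subtype.ext ?_
    exact formEigenspace_eq_zero_of_map_eq_zero one_half_pos hκ u.2 (congrArg Subtype.val hu)
  · rintro ⟨f, hf⟩
    obtain ⟨u, hu, rfl⟩ := mem_eigenspace_iff_exists.1 hf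
    exact ⟨⟨u, hu⟩, rfl⟩

/-- The inequality stays strict when `u` is zero in `L²`, since with zero vertex values `‖u'‖ = ‖u‖
> 0`. -/
theorem mul_norm_embL_lt_of_evalPoints_eq_zero {n : E → ℕ} {c Λ : ℝ} (hc : 0 < c)
    (hΛ : Λ < c ^ 2) (hn : ∀ e, c * Γ.length e < Real.pi * (n e + 1)) {u : Γ.FormDomain}
    (hu : ∀ i, Γ.evalPoints n i u = 0) (hu0 : u ≠ 0) :
    Λ * ‖Γ.embL u‖ ^ 2 < (⟪Γ.formOp α u, u⟫_ℂ).re := by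
  have hv : ∀ v, Γ.valL v u = 0 := fun v => hu (Sum.inl v)
  have h1 := norm_sq_eq_formDomain u
  rw [re_inner_formOp]
  simp only [hv, norm_zero, ne_eq, OfNat.ofNat_ne_zero, not_false_eq_true, zero_pow, mul_zero,
    Finset.sum_const_zero, add_zero, zero_add] at h1 ⊢
  have h2 : 0 < ‖Γ.derL u‖ ^ 2 := h1 ▸ pow_pos (norm_pos_iff.2 hu0) 2
  have h3 := sq_mul_norm_embL_le hc.le hn hu
  rcases (sq_nonneg ‖Γ.embL u‖).eq_or_lt' with h | h
  · rwa [h, mul_zero]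
  · exact (mul_lt_mul_of_pos_right hΛ h).trans_le h3

theorem sum_finrank_formEigenspace_le_card {n : E → ℕ} {c Λ : ℝ} (hc : 0 < c)
    (hΛ : Λ < c ^ 2) (hn : ∀ e, c * Γ.length e < Real.pi * (n e + 1)) (S : Finset ℝ)
    (hS : ∀ μ ∈ S, μ ≤ Λ) :
    (∀ μ ∈ S, FiniteDimensional ℂ (formEigenspace (Γ.formOp α) Γ.embL μ)) ∧
      ∑ μ ∈ S, finrank ℂ (formEigenspace (Γ.formOp α) Γ.embL μ) ≤
        Fintype.card V + ∑ e, n e := by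
  obtain ⟨κ, hκ⟩ := Γ.exists_coercive α
  have h := sum_finrank_formEigenspace_le isSelfAdjoint_formOp one_half_pos hκ
    (LinearMap.pi fun i => (Γ.evalPoints n i : Γ.FormDomain →ₗ[ℂ] ℂ)) (Λ := Λ)
    (fun u hu hu0 => mul_norm_embL_lt_of_evalPoints_eq_zero hc hΛ hn
      (fun i => congrFun hu i) hu0) S hS
  simpa using h

theorem exists_pos_lt_sq (Γ : MetricGraph V E) (Λ : ℝ) : ∃ (n : E → ℕ) (c : ℝ), 0 < c ∧ Λ < c ^ 2 ∧
    ∀ e, c * Γ.length e < Real.pi * (n e + 1) := by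
  refine ⟨fun e => ⌊(|Λ| + 1) * Γ.length e / Real.pi⌋₊, |Λ| + 1, by positivity, ?_, fun e => ?_⟩
  · nlinarith [le_abs_self Λ, abs_nonneg Λ]
  · rw [mul_comm Real.pi, ← div_lt_iff₀ Real.pi_pos]
    exact Nat.lt_floor_add_one _

theorem finiteDimensional_formEigenspace (μ : ℝ) :
    FiniteDimensional ℂ (formEigenspace (Γ.formOp α) Γ.embL μ) := by
  obtain ⟨n, c, hc, hΛ, hn⟩ := Γ.exists_pos_lt_sq μ
  exact (sum_finrank_formEigenspace_le_card hc hΛ hn {μ} (by simp)).1 μ (by simp)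

theorem finite_setOf_finrank_ne_zero (Λ : ℝ) :
    {μ | μ ≤ Λ ∧ finrank ℂ (formEigenspace (Γ.formOp α) Γ.embL μ) ≠ 0}.Finite := by
  obtain ⟨n, c, hc, hΛ, hn⟩ := Γ.exists_pos_lt_sq Λ
  by_contra hinf
  obtain ⟨S, hS, hcard⟩ := Set.Infinite.exists_subset_card_eq hinf
    (Fintype.card V + ∑ e, n e + 1)
  have h1 := (sum_finrank_formEigenspace_le_card (α := α) hc hΛ hn S fun μ hμ => (hS hμ).1).2
  have h2 : ∑ μ ∈ S, 1 ≤ ∑ μ ∈ S, finrank ℂ (formEigenspace (Γ.formOp α) Γ.embL μ) :=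
    Finset.sum_le_sum fun μ hμ => Nat.one_le_iff_ne_zero.2 (hS hμ).2
  rw [Finset.sum_const, smul_eq_mul, mul_one] at h2
  omega

theorem sum_le_sum_finrank_formEigenspace {n : E → ℕ} {s : ℝ}
    (hn : ∀ e, n e * Real.pi ≤ s * Γ.length e) :
    ∃ S : Finset ℝ, (∀ μ ∈ S, μ ≤ s ^ 2) ∧
      ∑ e, n e ≤ ∑ μ ∈ S, finrank ℂ (formEigenspace (Γ.formOp α) Γ.embL μ) := by
  classical
  obtain ⟨κ, hκ⟩ := Γ.exists_coercive α
  obtain ⟨Ψ, hΨ, hle⟩ := exists_dirichlet_testSpace (α := α) hn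
  set T := (finite_setOf_finrank_ne_zero (Γ := Γ) (α := α) (s ^ 2 + 1)).toFinset with hT
  -- Min–max only reaches levels above `s²`. As eigenvalues are locally finite, some `Λ' > s²` has
  -- none in `(s², Λ']`.
  obtain ⟨Λ', h1, h2, h3⟩ : ∃ Λ', s ^ 2 < Λ' ∧ Λ' ≤ s ^ 2 + 1 ∧ ∀ μ ∈ T, μ ≤ Λ' → μ ≤ s ^ 2 := by
    have h : ∀ᶠ x in nhdsWithin (s ^ 2) (Ioi (s ^ 2)), ∀ μ ∈ T, μ ≤ x → μ ≤ s ^ 2 := by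
      refine (Filter.eventually_all_finset T).2 fun μ _ => ?_
      by_cases hμ : μ ≤ s ^ 2
      · exact Filter.Eventually.of_forall fun _ _ => hμ
      · filter_upwards [Ioo_mem_nhdsGT (not_le.1 hμ)] with x hx hx'
        exact absurd hx' (not_le.2 hx.2)
    obtain ⟨x, hx, hx'⟩ := (h.and (Ioo_mem_nhdsGT (lt_add_one (s ^ 2)))).exists
    exact ⟨x, hx'.1, hx'.2.le, hx⟩
  refine ⟨T.filter (· ≤ s ^ 2), fun μ hμ => (Finset.mem_filter.1 hμ).2, ?_⟩
  have h := le_sum_finrank_formEigenspace isSelfAdjoint_formOp isCompactOperator_embL one_half_pos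
    hκ Ψ hΨ h1 hle (T.filter (· ≤ s ^ 2)) (fun μ hμ hne => ?_)
    fun μ _ => finiteDimensional_formEigenspace μ
  · simpa using h
  · have hμT : μ ∈ T := by
      rw [hT, Set.Finite.mem_toFinset]
      have := finiteDimensional_formEigenspace (Γ := Γ) (α := α) μ
      exact ⟨hμ.trans h2, fun h0 => hne (Submodule.finrank_eq_zero.1 h0)⟩
    exact Finset.mem_filter.2 ⟨hμT, h3 μ hμT hμ⟩

theorem exists_isEigenvalueSequence (Γ : MetricGraph V E) (α : V → ℝ) :
    ∃ lam : ℕ → ℝ, Γ.IsEigenvalueSequence α lam := by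
  obtain ⟨lam, hmono, h⟩ := exists_monotone_ncard_eq
    (D := fun μ => finrank ℂ (formEigenspace (Γ.formOp α) Γ.embL μ))
    finite_setOf_finrank_ne_zero fun m => by
      -- Large enough that every edge has at least `m` Dirichlet frequencies up to `s`.
      let s : ℝ := ∑ e, m * Real.pi / Γ.length e
      have hs : ∀ e, m * Real.pi ≤ s * Γ.length e := fun e => by
        rw [← div_le_iff₀ (Γ.length_pos e)]
        exact Finset.single_le_sum (f := fun e => m * Real.pi / Γ.length e)
          (fun e _ => div_nonneg (by positivity) (Γ.length_pos e).le) (Finset.mem_univ e)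
      obtain ⟨S, -, hS⟩ := sum_le_sum_finrank_formEigenspace (α := α) (n := fun _ => m) hs
      refine ⟨S, le_trans ?_ hS⟩
      rw [Finset.sum_const, smul_eq_mul]
      exact Nat.le_mul_of_pos_left m (Finset.card_pos.2 Finset.univ_nonempty)
  refine ⟨lam, hmono, fun μ => ?_, fun μ => ?_⟩ <;>
    obtain ⟨e⟩ := nonempty_formEigenspace_equiv_eigenspace (Γ := Γ) (α := α) μ
  · have := finiteDimensional_formEigenspace (Γ := Γ) (α := α) μ
    exact ⟨Module.Finite.equiv e, (h μ).1⟩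
  · exact (h μ).2.trans e.finrank_eq

theorem totalLength_pos (Γ : MetricGraph V E) : 0 < Γ.totalLength :=
  Finset.sum_pos (fun e _ => Γ.length_pos e) Finset.univ_nonempty

/-! ### The bounds for an eigenvalue sequence -/

namespace IsEigenvalueSequence

variable {lam : ℕ → ℝ}

theorem ncard_eq_finrank_formEigenspace (h : Γ.IsEigenvalueSequence α lam) (μ : ℝ) :
    {k | lam k = μ}.ncard = finrank ℂ (formEigenspace (Γ.formOp α) Γ.embL μ) := by
  obtain ⟨e⟩ := nonempty_formEigenspace_equiv_eigenspace (Γ := Γ) (α := α) μ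
  exact (h.card_eq μ).trans e.finrank_eq.symm

theorem finite_and_ncard_mem (h : Γ.IsEigenvalueSequence α lam) (S : Finset ℝ) :
    {k | lam k ∈ S}.Finite ∧ {k | lam k ∈ S}.ncard =
      ∑ μ ∈ S, finrank ℂ (formEigenspace (Γ.formOp α) Γ.embL μ) :=
  finite_and_ncard_eq_sum (fun μ => (h.finite_mult μ).2) h.ncard_eq_finrank_formEigenspace S

theorem exists_le_sum_finrank (h : Γ.IsEigenvalueSequence α lam) (k : ℕ) :
    ∃ S : Finset ℝ, (∀ μ ∈ S, μ ≤ lam k) ∧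
      k + 1 ≤ ∑ μ ∈ S, finrank ℂ (formEigenspace (Γ.formOp α) Γ.embL μ) := by
  classical
  let S := (Finset.range (k + 1)).image lam
  refine ⟨S, fun μ hμ => ?_, ?_⟩
  · obtain ⟨j, hj, rfl⟩ := Finset.mem_image.1 hμ
    exact h.monotone (Nat.lt_succ_iff.1 (Finset.mem_range.1 hj))
  · obtain ⟨h1, h2⟩ := h.finite_and_ncard_mem S
    rw [← h2, ← Finset.card_range (k + 1), ← Set.ncard_coe_finset]
    refine Set.ncard_le_ncard (fun j hj => ?_) h1
    exact Finset.mem_image_of_mem lam hj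

/-- If `lam k` exceeded `Λ`, monotonicity would leave only the `k` indices below `k` for values in
`S`. -/
theorem le_of_lt_sum_finrank (h : Γ.IsEigenvalueSequence α lam) {k : ℕ} {Λ : ℝ} {S : Finset ℝ}
    (hS : ∀ μ ∈ S, μ ≤ Λ)
    (hk : k < ∑ μ ∈ S, finrank ℂ (formEigenspace (Γ.formOp α) Γ.embL μ)) : lam k ≤ Λ := by
  by_contra! hlt
  obtain ⟨-, h2⟩ := h.finite_and_ncard_mem S
  rw [← h2] at hk
  refine hk.not_ge ?_
  have h3 : {j | lam j ∈ S} ⊆ ↑(Finset.range k) := fun j hj => by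
    rw [Finset.coe_range, Set.mem_Iio]
    by_contra! hkj
    exact ((hS _ hj).trans_lt hlt).not_ge (h.monotone hkj)
  calc {j | lam j ∈ S}.ncard ≤ (↑(Finset.range k) : Set ℕ).ncard :=
        Set.ncard_le_ncard h3 (Finset.finite_toSet _)
    _ = k := by rw [Set.ncard_coe_finset, Finset.card_range]

/-- Each floor loses strictly less than one, so `∑ ⌊sℓ_e/π⌋ > sℒ/π - |E| = k`. -/
theorem le_sq (h : Γ.IsEigenvalueSequence α lam) (k : ℕ) :
    lam k ≤ (((k : ℝ) + Fintype.card E) * Real.pi / Γ.totalLength) ^ 2 := by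
  have hL := totalLength_pos Γ
  set s : ℝ := ((k : ℝ) + Fintype.card E) * Real.pi / Γ.totalLength with hs
  have hs0 : 0 ≤ s := by positivity
  have hn : ∀ e, (⌊s * Γ.length e / Real.pi⌋₊ : ℝ) * Real.pi ≤ s * Γ.length e := fun e => by
    rw [← le_div_iff₀ Real.pi_pos]
    exact Nat.floor_le (div_nonneg (mul_nonneg hs0 (Γ.length_pos e).le) Real.pi_pos.le)
  obtain ⟨S, hS, hle⟩ := sum_le_sum_finrank_formEigenspace (α := α) hn
  refine h.le_of_lt_sum_finrank hS (lt_of_lt_of_le ?_ hle)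
  have h1 : ∑ e, s * Γ.length e / Real.pi < ∑ e, ((⌊s * Γ.length e / Real.pi⌋₊ : ℝ) + 1) :=
    Finset.sum_lt_sum_of_nonempty Finset.univ_nonempty fun e _ => Nat.lt_floor_add_one _
  rw [← Finset.sum_div, ← Finset.mul_sum, ← totalLength, hs, Finset.sum_add_distrib,
    div_mul_cancel₀ _ hL.ne', mul_div_cancel_right₀ _ Real.pi_ne_zero, Finset.sum_const,
    Finset.card_univ, nsmul_eq_mul, mul_one, add_lt_add_iff_right, ← Nat.cast_sum,
    Nat.cast_lt] at h1
  rwa [← hs] at h1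

theorem sq_le_of_card_le (h : Γ.IsEigenvalueSequence α lam) {k : ℕ} (hk : Fintype.card V ≤ k) :
    (((k : ℝ) - Fintype.card V + 1) * Real.pi / Γ.totalLength) ^ 2 ≤ lam k := by
  have hL := totalLength_pos Γ
  have hk' : (Fintype.card V : ℝ) ≤ k := by exact_mod_cast hk
  set s : ℝ := ((k : ℝ) - Fintype.card V + 1) * Real.pi / Γ.totalLength with hs
  have hs0 : 0 < s := div_pos (mul_pos (by linarith) Real.pi_pos) hL
  by_contra! hlt
  -- For a negative eigenvalue this is `0`; then all `n e` vanish and the argument still applies, as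
  -- `s > 0`.
  set c₀ := √(lam k) with hc₀
  have hc₀s : c₀ < s := (Real.sqrt_lt' hs0).2 hlt
  have hc₀0 : 0 ≤ c₀ := Real.sqrt_nonneg _
  let n : E → ℕ := fun e => ⌊c₀ * Γ.length e / Real.pi⌋₊
  -- Counting needs `lam k < c²` strictly. The condition on the pieces is open, so `c` can be moved
  -- slightly above `c₀` with the same number of points.
  obtain ⟨c, hc, hc'⟩ : ∃ c, (∀ e, c * Γ.length e < Real.pi * (n e + 1)) ∧ c₀ < c := by
    have hev : ∀ᶠ c in nhdsWithin c₀ (Ioi c₀), ∀ e, c * Γ.length e < Real.pi * (n e + 1) := by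
      refine Filter.eventually_all.2 fun e => nhdsWithin_le_nhds ?_
      refine (continuous_id.mul continuous_const).continuousAt.eventually_lt
        continuousAt_const ?_
      rw [mul_comm Real.pi, ← div_lt_iff₀ Real.pi_pos]
      exact Nat.lt_floor_add_one _
    exact (hev.and self_mem_nhdsWithin).exists
  obtain ⟨S, hS, hkS⟩ := h.exists_le_sum_finrank k
  have h1 := (sum_finrank_formEigenspace_le_card (α := α) (hc₀0.trans_lt hc')
    ((Real.sqrt_lt' (hc₀0.trans_lt hc')).1 hc') hc S hS).2
  have h2 : ∑ e, (n e : ℝ) ≤ c₀ * Γ.totalLength / Real.pi := by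
    rw [totalLength, Finset.mul_sum, Finset.sum_div]
    exact Finset.sum_le_sum fun e _ => Nat.floor_le
      (div_nonneg (mul_nonneg hc₀0 (Γ.length_pos e).le) Real.pi_pos.le)
  have h3 : c₀ * Γ.totalLength / Real.pi < k - Fintype.card V + 1 := by
    rw [div_lt_iff₀ Real.pi_pos, ← lt_div_iff₀ hL]
    exact hc₀s
  have h4 : (k : ℝ) + 1 ≤ Fintype.card V + ∑ e, (n e : ℝ) := by exact_mod_cast hkS.trans h1
  linarith

/-- Vanishing at the vertices with `α v < 0` makes the form nonnegative. A nonnegative total leaves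
at least one vertex free, so fewer than `|V|` conditions are imposed and at most `|V| - 1`
eigenvalues are negative. -/
theorem nonneg_of_card_le (h : Γ.IsEigenvalueSequence α lam) (hα : 0 ≤ ∑ v, α v) {k : ℕ}
    (hk : Fintype.card V ≤ k + 1) : 0 ≤ lam k := by
  classical
  by_contra! hlt
  obtain ⟨κ, hκ⟩ := Γ.exists_coercive α
  obtain ⟨S, hS, hkS⟩ := h.exists_le_sum_finrank k
  have h1 := (sum_finrank_formEigenspace_le isSelfAdjoint_formOp one_half_pos hκ
    (LinearMap.pi fun v : {v // α v < 0} => (Γ.valL v.1 : Γ.FormDomain →ₗ[ℂ] ℂ)) (Λ := lam k)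
    (fun u hu hu0 => ?_) S hS).2
  · rw [finrank_pi] at h1
    obtain ⟨v, hv⟩ : ∃ v, ¬α v < 0 := by
      by_contra! hneg
      have := Γ.connected.nonempty
      exact hα.not_gt (Finset.sum_neg (fun v _ => hneg v) Finset.univ_nonempty)
    have := Fintype.card_subtype_lt (p := fun v => α v < 0) hv
    omega
  · have hv : ∀ v, 0 ≤ α v * ‖Γ.valL v u‖ ^ 2 := fun v => by
      by_cases hv : α v < 0
      · have hu' : Γ.valL v u = 0 := congrFun hu ⟨v, hv⟩
        simp [hu']
      · exact mul_nonneg (not_lt.1 hv) (sq_nonneg _)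
    have hform : 0 ≤ (⟪Γ.formOp α u, u⟫_ℂ).re := by
      rw [re_inner_formOp]
      exact add_nonneg (sq_nonneg _) (Finset.sum_nonneg fun v _ => hv v)
    rcases (sq_nonneg ‖Γ.embL u‖).eq_or_lt' with h0 | h0
    · have hu := hκ u
      have hu' := pow_pos (norm_pos_iff.2 hu0) 2
      rw [h0, mul_zero] at hu ⊢
      linarith
    · exact (mul_neg_of_neg_of_pos hlt h0).trans_le hform

theorem sq_le_of_sum_nonneg (h : Γ.IsEigenvalueSequence α lam) (hα : 0 ≤ ∑ v, α v) {k : ℕ}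
    (hk : Fintype.card V ≤ k + 1) :
    (((k : ℝ) - Fintype.card V + 1) * Real.pi / Γ.totalLength) ^ 2 ≤ lam k := by
  rcases hk.eq_or_lt with hk' | hk'
  · have : (k : ℝ) - Fintype.card V + 1 = 0 := by
      rw [hk']
      push_cast
      ring
    rw [this, zero_mul, zero_div, zero_pow two_ne_zero]
    exact h.nonneg_of_card_le hα hk
  · exact h.sq_le_of_card_le (Nat.lt_succ_iff.1 hk')

/-- This is `sq_le_of_card_le` at index `k - 1`, still at least `|V|`; the `+ 1` there absorbs the
shift. -/
theorem sq_le_pred (h : Γ.IsEigenvalueSequence α lam) {k : ℕ} (hk : Fintype.card V + 1 ≤ k) :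
    (((k : ℝ) - Fintype.card V) * Real.pi / Γ.totalLength) ^ 2 ≤ lam (k - 1) := by
  obtain ⟨k, rfl⟩ := Nat.exists_eq_add_of_le' (le_of_add_le_right hk)
  have := h.sq_le_of_card_le (k := k) (by omega)
  rw [Nat.add_sub_cancel]
  convert this using 4
  push_cast
  ring

theorem sq_sub_le (h : Γ.IsEigenvalueSequence α lam) {k : ℕ} (hk : Fintype.card V ≤ k) :
    (((k : ℝ) - Fintype.card V) * Real.pi / Γ.totalLength) ^ 2 ≤ lam k := by
  have hL := totalLength_pos Γ
  have hk' : (0 : ℝ) ≤ k - Fintype.card V := sub_nonneg.2 (by exact_mod_cast hk)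
  refine le_trans ?_ (h.sq_le_of_card_le hk)
  gcongr
  linarith

end IsEigenvalueSequence

end MetricGraph

end

theorem theorem4p2 {V E : Type*} [Fintype V] [Fintype E] [Nonempty E]
    (Γ : MetricGraph V E) (α : V → ℝ) :
    (∃ lam : ℕ → ℝ, Γ.IsEigenvalueSequence α lam) ∧
    ∀ lam : ℕ → ℝ, Γ.IsEigenvalueSequence α lam → ∀ k : ℕ,
      (∑ v, α v = 0 →
        (Fintype.card V ≤ k + 1 →
          (((k : ℝ) - Fintype.card V + 1) * Real.pi / Γ.totalLength) ^ 2 ≤ lam k) ∧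
        lam k ≤ (((k : ℝ) + Fintype.card E) * Real.pi / Γ.totalLength) ^ 2) ∧
      (0 < ∑ v, α v →
        (Fintype.card V ≤ k + 1 →
          (((k : ℝ) - Fintype.card V + 1) * Real.pi / Γ.totalLength) ^ 2 ≤ lam k) ∧
        lam k ≤ (((k : ℝ) + Fintype.card E + 1) * Real.pi / Γ.totalLength) ^ 2) ∧
      (∑ v, α v < 0 →
        (Fintype.card V ≤ k →
          (((k : ℝ) - Fintype.card V) * Real.pi / Γ.totalLength) ^ 2 ≤ lam k) ∧
        (Fintype.card V + 1 ≤ k →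
          (((k : ℝ) - Fintype.card V) * Real.pi / Γ.totalLength) ^ 2 ≤ lam (k - 1)) ∧
        lam k ≤ (((k : ℝ) + Fintype.card E) * Real.pi / Γ.totalLength) ^ 2) := by
  refine ⟨Γ.exists_isEigenvalueSequence α, fun lam h k => ⟨fun hα => ?_, fun hα => ?_, fun _ => ?_⟩⟩
  · exact ⟨h.sq_le_of_sum_nonneg hα.ge, h.le_sq k⟩
  -- The upper bound `le_sq` holds for every `α`, so the stated one is a weakening.
  · refine ⟨h.sq_le_of_sum_nonneg hα.le, (h.le_sq k).trans ?_⟩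
    have hL := MetricGraph.totalLength_pos Γ
    gcongr (?_ * _ / _) ^ 2
    exact le_add_of_nonneg_right zero_le_one
  · exact ⟨h.sq_sub_le, h.sq_le_pred, h.le_sq k⟩
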